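/- Let $n\ge 1$ and let $x_0,\dots,x_n>0$ be real numbers; put $y_k=x_0+\dots+x_k$. The Hilbert–Galton board $Z^{(n)}$ is the continuous-time Markov chain on $\mathbb Z_{\ge0}^n$ in which $c=(c_1,\dots,c_n)$ moves to $(0,c_1,\dots,c_{n-1})$ at rate $x_0$ and, for each $1\le j\le n$, to $(c_1,\dots,c_{j-1},c_j+1,c_{j+1},\dots,c_n)$ at rate $x_j$. Let $\mathcal A_n$ be the set of triangular arrays $A=(A_{k,j})_{1\le j\le k\le n}$ of nonnegative integers. The enriched Hilbert–Galton board $X^{(n)}$ is the continuous-time Markov chain on $\mathcal A_n$ in which $A$ moves at rate $x_0$ to the array $A'$ with $A'_{k,k}=0$ for $1\le k\le n$ and $A'_{k,j}=A_{k-1,j}$ for $1\le j<k\le n$, and, for each $1\le i\le n$, moves at rate $x_i$ to the array obtained from $A$ by increasing $A_{i,i}$ by one. For $A\in\mathcal A_n$ and $1\le i\le n$ set $h_i(A)=\sum_{j=1}^i A_{i,j}$, $v_i(A)=\sum_{k=i}^n A_{k,i}$, $d_i(A)=\sum_{j=1}^i A_{n-i+j,j}$, and $$w_x(A)=x_0^n\prod_{k=1}^n\binom{d_k(A)}{A_{n-k+1,1},\dots,A_{n,k}}\frac{x_k^{v_k(A)}}{y_k^{d_k(A)+1}},\qquad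 \binom{m_1+\dots+m_k}{m_1,\dots,m_k}=\frac{(m_1+\dots+m_k)!}{m_1!\cdots m_k!}.$$ Then $X^{(n)}$ exists for every initial law on $\mathcal A_n$ (as a process with right-continuous paths), is irreducible and positive recurrent (for every state, the expected return time is finite), and has a unique stationary probability distribution, which is given by $\pi_{X^{(n)}}(A)=w_x(A)$ for all $A\in\mathcal A_n$. Moreover, with $p_n(A)=(h_1(A),\dots,h_n(A))$, for every initial law of $X^{(n)}$ the process $p_n(X^{(n)})$ is a Markov chain with the transition rates of $Z^{(n)}$, and it has the same law as $Z^{(n)}$ started from the law of $p_n(X^{(n)}(0))$. -/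

import Mathlib

open scoped NNReal ENNReal Nat

noncomputable section

namespace HilbertGalton

/-! Continuous-time Markov chains on a countable set `S` with finitely many kinds of transitions:
from a state `a`, the chain moves to `T j a` at rate `r j`, for each `j : ι`.
(Several `j` may lead to the same state, then the rates add up; a `j` with `T j a = a` is a
transition without effect.) -/

section Chains

variable {S ι : Type*} [Fintype ι]

/-- The (bounded) generator `(L f)(a) = ∑ j, r j * (f (T j a) - f a)`. -/
def generator (r : ι → ℝ) (T : ι → S → S) (f : S → ℝ) : S → ℝ :=
  fun a => ∑ j, r j * (f (T j a) - f a)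

/-- The semigroup `exp (t L)` as a power series. For bounded `f` the series converges absolutely,
since `|L ^ k f| ≤ (2 * ∑ j, |r j|) ^ k * sup |f|`. -/
def semigroup (r : ι → ℝ) (T : ι → S → S) (t : ℝ) (f : S → ℝ) (a : S) : ℝ :=
  ∑' k : ℕ, t ^ k / (k ! : ℝ) * ((generator r T)^[k] f) a

/-- The transition probability `p_t(a, b)`, the `(a, b)` entry of `exp (t L)`. -/
def transProb (r : ι → ℝ) (T : ι → S → S) (t : ℝ≥0) (a b : S) : ℝ :=
  semigroup r T (t : ℝ) (Set.indicator {b} (fun _ => (1 : ℝ))) a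

/-- `X` is, under the probability measure `μ`, a (version with right-continuous paths of the)
continuous-time Markov chain with transitions `a → T j a` at rates `r j`, with any initial law.
The Markov property is with respect to the past `σ(X u, u ≤ s)`. -/
structure IsMarkovChain [MeasurableSpace S] (r : ι → ℝ) (T : ι → S → S)
    {Ω : Type*} [MeasurableSpace Ω] (μ : MeasureTheory.Measure Ω) (X : ℝ≥0 → Ω → S) : Prop where
  isProbabilityMeasure : MeasureTheory.IsProbabilityMeasure μ
  measurable : ∀ t, Measurable (X t)
  rightContinuous : ∀ᵐ ω ∂μ, ∀ t : ℝ≥0, ∃ ε : ℝ≥0, 0 < ε ∧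
    ∀ u, t ≤ u → u < t + ε → X u ω = X t ω
  markov : ∀ (s t : ℝ≥0) (E : Set Ω),
    @MeasurableSet Ω (⨆ u ∈ Set.Iic s, MeasurableSpace.comap (X u) inferInstance) E →
    ∀ a b : S, μ.real (E ∩ {ω | X s ω = a} ∩ {ω | X (s + t) ω = b}) =
      μ.real (E ∩ {ω | X s ω = a}) * transProb r T t a b

/-- Any state can be reached from any state with positive probability. -/
def IsIrreducibleChain (r : ι → ℝ) (T : ι → S → S) : Prop :=
  ∀ a b : S, ∃ t : ℝ≥0, 0 < transProb r T t a b

/-- The first time a path is not at `a` (infinite if there is none). -/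
def exitTime (a : S) (path : ℝ≥0 → S) : ℝ≥0∞ :=
  ⨅ (t : ℝ≥0) (_ : path t ≠ a), (t : ℝ≥0∞)

/-- The first time, not before the exit time from `a`, at which a path is at `a`
(infinite if there is none). -/
def returnTime (a : S) (path : ℝ≥0 → S) : ℝ≥0∞ :=
  ⨅ (t : ℝ≥0) (_ : exitTime a path ≤ t ∧ path t = a), (t : ℝ≥0∞)

/-- For every state `a`, the chain started at `a` has a return time to `a` with finite
expectation. -/
def IsPositiveRecurrent [MeasurableSpace S] (r : ι → ℝ) (T : ι → S → S) : Prop :=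
  ∀ (a : S) (Ω : Type) [MeasurableSpace Ω] (μ : MeasureTheory.Measure Ω) (X : ℝ≥0 → Ω → S),
    IsMarkovChain r T μ X → (∀ᵐ ω ∂μ, X 0 ω = a) →
      ∫⁻ ω, returnTime a (fun t => X t ω) ∂μ < ∞

/-- `π` is a stationary probability distribution: `π p_t = π` for all `t`. -/
structure IsStationary (r : ι → ℝ) (T : ι → S → S) (π : S → ℝ) : Prop where
  nonneg : ∀ a, 0 ≤ π a
  hasSum_one : HasSum π 1
  invariant : ∀ (t : ℝ≥0) (b : S), HasSum (fun a => π a * transProb r T t a b) (π b)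

end Chains

/-- The transition maps `U_j`, `0 ≤ j ≤ n`, of the Hilbert–Galton board on `n`-tuples; the
content of the `i`-th bin, `1 ≤ i ≤ n`, is the coordinate with index `i - 1` in `Fin n`. -/
def boardStep (n : ℕ) (j : Fin (n + 1)) (c : Fin n → ℕ) : Fin n → ℕ :=
  Fin.cases (motive := fun _ => Fin n → ℕ)
    (fun i => if (i : ℕ) = 0 then 0 else c ⟨(i : ℕ) - 1, by omega⟩)
    (fun m i => if i = m then c i + 1 else c i) j

/-- The positions `(k, j)` (row, column) with `1 ≤ j ≤ k ≤ n`. -/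
abbrev triangle (n : ℕ) : Finset (ℕ × ℕ) :=
  (Finset.Icc 1 n ×ˢ Finset.Icc 1 n).filter (fun p => p.2 ≤ p.1)

/-- Triangular arrays of size `n`. -/
abbrev TriArray (n : ℕ) : Type := triangle n → ℕ

/-- The entry in row `k` and column `j`; zero outside the triangle. -/
def entry {n : ℕ} (A : TriArray n) (k j : ℕ) : ℕ :=
  if h : (k, j) ∈ triangle n then A ⟨(k, j), h⟩ else 0

/-- Row sums. -/
def rowSum {n : ℕ} (A : TriArray n) (i : ℕ) : ℕ := ∑ j ∈ Finset.Icc 1 i, entry A i j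

/-- Column sums. -/
def colSum {n : ℕ} (A : TriArray n) (i : ℕ) : ℕ := ∑ k ∈ Finset.Icc i n, entry A k i

/-- Diagonal sums, for `1 ≤ i ≤ n`. -/
def diagSum {n : ℕ} (A : TriArray n) (i : ℕ) : ℕ := ∑ j ∈ Finset.Icc 1 i, entry A (n - i + j) j

/-- The transition maps of the enriched Hilbert–Galton board: for `j = 0` the rows move down by
one, the last row is lost and new diagonal entries `0` appear; for `1 ≤ j ≤ n` the diagonal entry
`(j, j)` increases by one. -/
def triStep (n : ℕ) (j : Fin (n + 1)) (A : TriArray n) : TriArray n :=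
  fun p => if (j : ℕ) = 0 then entry A (p.1.1 - 1) p.1.2
    else if p.1 = ((j : ℕ), (j : ℕ)) then A p + 1 else A p

/-- The projection to the tuple of row sums. -/
def rowSums (n : ℕ) (A : TriArray n) : Fin n → ℕ := fun i => rowSum A ((i : ℕ) + 1)

/-- `y_k = x_0 + ⋯ + x_k`. -/
def partialRate {n : ℕ} (x : Fin (n + 1) → ℝ) (k : Fin (n + 1)) : ℝ := ∑ j ∈ Finset.Iic k, x j

/-- The weight `w_x(A)`; the factor with index `i : Fin n` is the one for `k = i + 1`. -/
def weight {n : ℕ} (x : Fin (n + 1) → ℝ) (A : TriArray n) : ℝ :=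
  x 0 ^ n * ∏ i : Fin n,
    (Nat.multinomial (Finset.Icc 1 ((i : ℕ) + 1)) (fun j => entry A (n - ((i : ℕ) + 1) + j) j) : ℝ)
      * (x i.succ ^ colSum A ((i : ℕ) + 1) / partialRate x i.succ ^ (diagSum A ((i : ℕ) + 1) + 1))

end HilbertGalton

end

open scoped NNReal ENNReal Nat

noncomputable section

/-! Write `Λ` for the total rate and `J f a = ∑ j, r j * f (T j a)`. The generator is `J - Λ`, so
`exp (t L) = exp (-Λ t) ∑ t ^ k / k! J ^ k` (`semigroup_eq_exp_mul_tsum`). All terms are nonnegative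
on nonnegative functions, and the version `heat` with values in `[0, ∞]` allows free interchange of
sums.

Stationarity: the weight is a product over the diagonals of negative multinomial laws
(`weight_eq_prod`). A transition of kind 0 turns diagonal `k + 1` into diagonal `k`, dropping its
entry in the last row, and empties the main diagonal, which has index `n`. Summing a factor over the
dropped entry is a negative binomial series and gives the factor with index `k`
(`hasSum_diagFactor_succ`), so the laws of the diagonals below `n` are reproduced. The other
transitions touch only the main diagonal, and the balance equations reduce to that of a single
factor (`diagFactor_balance`). Since `n` shifts push the weight to the point mass at the zero array,
its total mass is one (`tsum_shiftedWeight_eq_one`).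

Irreducibility, recurrence, uniqueness: `n` shifts erase the initial state, so for each `b` one word
of transitions leads from every state to `b` (`exists_reset_triStep`). Hence the transition
probabilities to `b` are bounded below uniformly in the initial state (`exists_pos_le_heat`). This
Doeblin bound gives geometric tails for return times and rules out a second stationary law.

Existence: the path is driven by i.i.d. exponential waiting times with independent kinds of
transitions. Conditioning on the first transition gives a renewal equation whose bounded solutions
are unique (`le_of_renewal`), and `heat` solves it (`heat_renewal`).

Projection: row sums intertwine the transition maps of the two chains (`rowSums_triStep`), so they
form a Markov chain (`IsMarkovChain.comp_of_intertwine`), whose law is determined by its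
finite-dimensional distributions (`IsMarkovChain.map_eq`). -/

namespace HilbertGalton

/-! ### The transition semigroup as a Poisson mixture of powers of the jump operator. -/

section Heat

variable {S ι : Type*} [Fintype ι]

/-- The sum of the rates of all kinds of transitions. -/
def totalRate (r : ι → ℝ) : ℝ := ∑ j, r j

/-- The operator `f ↦ ∑ j, r j * f (T j ·)` on real functions. -/
def realJump (r : ι → ℝ) (T : ι → S → S) : Module.End ℝ (S → ℝ) where
  toFun f a := ∑ j, r j * f (T j a)
  map_add' f g := by
    ext a
    simp [mul_add, Finset.sum_add_distrib]
  map_smul' c f := by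
    ext a
    simp only [Pi.smul_apply, smul_eq_mul, RingHom.id_apply, Finset.mul_sum]
    exact Finset.sum_congr rfl fun j _ => by ring

theorem realJump_apply (r : ι → ℝ) (T : ι → S → S) (f : S → ℝ) (a : S) :
    realJump r T f a = ∑ j, r j * f (T j a) := rfl

theorem generator_eq_realJump (r : ι → ℝ) (T : ι → S → S) :
    generator r T = ⇑(realJump r T + (-totalRate r) • (1 : Module.End ℝ (S → ℝ))) := by
  ext f a
  simp only [generator, LinearMap.add_apply, LinearMap.smul_apply, Module.End.one_apply,
    Pi.add_apply, Pi.smul_apply, realJump_apply, smul_eq_mul, totalRate, mul_sub,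
    Finset.sum_sub_distrib]
  rw [neg_mul, Finset.sum_mul, sub_eq_add_neg]

theorem abs_realJump_pow_le {r : ι → ℝ} (hr : ∀ j, 0 ≤ r j) (T : ι → S → S) {f : S → ℝ} {C : ℝ}
    (hf : ∀ a, |f a| ≤ C) (k : ℕ) (a : S) : |(realJump r T ^ k) f a| ≤ totalRate r ^ k * C := by
  induction k generalizing a with
  | zero => simpa using hf a
  | succ k ih =>
    rw [pow_succ', Module.End.mul_apply, realJump_apply]
    refine (Finset.abs_sum_le_sum_abs _ _).trans ?_
    rw [pow_succ', mul_assoc, totalRate, Finset.sum_mul]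
    refine Finset.sum_le_sum fun j _ => ?_
    rw [abs_mul, abs_of_nonneg (hr j)]
    exact mul_le_mul_of_nonneg_left (ih _) (hr j)

/-- The jump operator commutes with the scalar `-Λ`, so the binomial theorem applies. -/
theorem generator_iterate_apply (r : ι → ℝ) (T : ι → S → S) (f : S → ℝ) (k : ℕ) (a : S) :
    (generator r T)^[k] f a = ∑ m ∈ Finset.HasAntidiagonal.antidiagonal k,
      (k.choose m.1 : ℝ) * ((-totalRate r) ^ m.2 * (realJump r T ^ m.1) f a) := by
  have hc : Commute (realJump r T) ((-totalRate r) • (1 : Module.End ℝ (S → ℝ))) :=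
    (Commute.one_right _).smul_right _
  rw [generator_eq_realJump, ← Module.End.pow_apply, hc.add_pow']
  simp only [smul_pow, one_pow, LinearMap.sum_apply, Finset.sum_apply]
  refine Finset.sum_congr rfl fun m _ => ?_
  rw [mul_smul_comm, mul_one, LinearMap.smul_apply, LinearMap.smul_apply, Pi.smul_apply,
    Pi.smul_apply, nsmul_eq_mul, smul_eq_mul]

theorem summable_realJump {r : ι → ℝ} (hr : ∀ j, 0 ≤ r j) (T : ι → S → S) {f : S → ℝ} {C : ℝ}
    (hf : ∀ a, |f a| ≤ C) (t : ℝ) (a : S) :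
    Summable fun k : ℕ => ‖t ^ k / (k ! : ℝ) * (realJump r T ^ k) f a‖ := by
  refine Summable.of_nonneg_of_le (fun _ => norm_nonneg _) (fun k => ?_)
    ((Real.summable_pow_div_factorial (|t| * totalRate r)).mul_right C)
  rw [Real.norm_eq_abs, abs_mul, abs_div, abs_pow, Nat.abs_cast, mul_pow, mul_div_right_comm,
    mul_assoc]
  exact mul_le_mul_of_nonneg_left (abs_realJump_pow_le hr T hf k a) (by positivity)

/-- Cauchy product of the series of `exp (-Λ t)` and of the jump operator: its antidiagonal sums are
the binomial expansions of the powers of the generator. Boundedness of `f` gives absolute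
convergence. -/
theorem semigroup_eq_exp_mul_tsum {r : ι → ℝ} (hr : ∀ j, 0 ≤ r j) (T : ι → S → S) {f : S → ℝ}
    {C : ℝ} (hf : ∀ a, |f a| ≤ C) (t : ℝ) (a : S) :
    semigroup r T t f a =
      Real.exp (-(totalRate r * t)) * ∑' k : ℕ, t ^ k / (k ! : ℝ) * (realJump r T ^ k) f a := by
  have hexp : Real.exp (-(totalRate r * t)) = ∑' k : ℕ, (-(totalRate r * t)) ^ k / (k ! : ℝ) := by
    rw [Real.exp_eq_exp_ℝ, NormedSpace.exp_eq_tsum_div]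
  have hs : Summable fun k : ℕ => ‖(-(totalRate r * t)) ^ k / (k ! : ℝ)‖ :=
    (Real.summable_pow_div_factorial _).norm
  rw [hexp, mul_comm, tsum_mul_tsum_eq_tsum_sum_antidiagonal_of_summable_norm
    (summable_realJump hr T hf t a) hs, semigroup]
  refine tsum_congr fun k => ?_
  rw [generator_iterate_apply, Finset.mul_sum]
  refine Finset.sum_congr rfl fun m hm => ?_
  obtain rfl := Finset.HasAntidiagonal.mem_antidiagonal.mp hm
  rw [Nat.cast_add_choose]
  have h1 : ((m.1 + m.2)! : ℝ) ≠ 0 := by positivity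
  have h2 : (m.1 ! : ℝ) ≠ 0 := by positivity
  have h3 : (m.2 ! : ℝ) ≠ 0 := by positivity
  field_simp
  rw [pow_add, neg_pow (totalRate r * t), mul_pow, neg_pow (totalRate r)]
  ring

/-- The operator `f ↦ ∑ j, r j * f (T j ·)` on functions with values in `[0, ∞]`. -/
def jumpOp (r : ι → ℝ) (T : ι → S → S) (f : S → ℝ≥0∞) : S → ℝ≥0∞ :=
  fun a => ∑ j, ENNReal.ofReal (r j) * f (T j a)

/-- The weight of `k` transitions up to time `t`. -/
def jumpWeight (r : ι → ℝ) (t : ℝ≥0) (k : ℕ) : ℝ≥0∞ :=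
  ENNReal.ofReal (Real.exp (-(totalRate r * t)) * ((t : ℝ) ^ k / (k ! : ℝ)))

/-- The transition semigroup on functions with values in `[0, ∞]`. -/
def heat (r : ι → ℝ) (T : ι → S → S) (t : ℝ≥0) (f : S → ℝ≥0∞) (a : S) : ℝ≥0∞ :=
  ∑' k : ℕ, jumpWeight r t k * (jumpOp r T)^[k] f a

theorem realJump_pow_nonneg {r : ι → ℝ} (hr : ∀ j, 0 ≤ r j) (T : ι → S → S) {f : S → ℝ}
    (hf : ∀ a, 0 ≤ f a) (k : ℕ) (a : S) : 0 ≤ (realJump r T ^ k) f a := by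
  induction k generalizing a with
  | zero => simpa using hf a
  | succ k ih =>
    rw [pow_succ', Module.End.mul_apply, realJump_apply]
    exact Finset.sum_nonneg fun j _ => mul_nonneg (hr j) (ih _)

theorem ofReal_realJump_pow {r : ι → ℝ} (hr : ∀ j, 0 ≤ r j) (T : ι → S → S) {f : S → ℝ}
    (hf : ∀ a, 0 ≤ f a) (k : ℕ) (a : S) :
    ENNReal.ofReal ((realJump r T ^ k) f a) =
      (jumpOp r T)^[k] (fun b => ENNReal.ofReal (f b)) a := by
  induction k generalizing a with
  | zero => simp
  | succ k ih =>
    rw [pow_succ', Module.End.mul_apply, realJump_apply, Function.iterate_succ_apply', jumpOp,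
      ENNReal.ofReal_sum_of_nonneg
        fun j _ => mul_nonneg (hr j) (realJump_pow_nonneg hr T hf k _)]
    refine Finset.sum_congr rfl fun j _ => ?_
    rw [ENNReal.ofReal_mul (hr j), ih]

theorem semigroup_nonneg {r : ι → ℝ} (hr : ∀ j, 0 ≤ r j) (T : ι → S → S) {f : S → ℝ} {C : ℝ}
    (hf : ∀ a, 0 ≤ f a) (hC : ∀ a, f a ≤ C) (t : ℝ≥0) (a : S) : 0 ≤ semigroup r T t f a := by
  rw [semigroup_eq_exp_mul_tsum hr T (C := C) (fun a => by rw [abs_of_nonneg (hf a)]; exact hC a)]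
  exact mul_nonneg (Real.exp_nonneg _) (tsum_nonneg fun k =>
    mul_nonneg (by positivity) (realJump_pow_nonneg hr T hf k a))

theorem ofReal_semigroup {r : ι → ℝ} (hr : ∀ j, 0 ≤ r j) (T : ι → S → S) {f : S → ℝ} {C : ℝ}
    (hf : ∀ a, 0 ≤ f a) (hC : ∀ a, f a ≤ C) (t : ℝ≥0) (a : S) :
    ENNReal.ofReal (semigroup r T t f a) = heat r T t (fun b => ENNReal.ofReal (f b)) a := by
  have habs : ∀ a, |f a| ≤ C := fun a => by rw [abs_of_nonneg (hf a)]; exact hC a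
  rw [semigroup_eq_exp_mul_tsum hr T habs, ← tsum_mul_left, ENNReal.ofReal_tsum_of_nonneg]
  · refine tsum_congr fun k => ?_
    rw [← mul_assoc, ENNReal.ofReal_mul (by positivity), ofReal_realJump_pow hr T hf, jumpWeight]
  · exact fun k => mul_nonneg (Real.exp_nonneg _)
      (mul_nonneg (by positivity) (realJump_pow_nonneg hr T hf k a))
  · exact (summable_realJump hr T habs t a).of_norm.mul_left _

theorem transProb_nonneg {r : ι → ℝ} (hr : ∀ j, 0 ≤ r j) (T : ι → S → S) (t : ℝ≥0) (a b : S) :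
    0 ≤ transProb r T t a b :=
  semigroup_nonneg hr T (C := 1) (fun _ => Set.indicator_nonneg (fun _ _ => zero_le_one) _)
    (fun _ => Set.indicator_le_self' (fun _ _ => zero_le_one) _) t a

theorem ofReal_transProb {r : ι → ℝ} (hr : ∀ j, 0 ≤ r j) (T : ι → S → S) (t : ℝ≥0) (a b : S) :
    ENNReal.ofReal (transProb r T t a b) = heat r T t (Set.indicator {b} 1) a := by
  rw [transProb, ofReal_semigroup hr T (C := 1)
    (fun _ => Set.indicator_nonneg (fun _ _ => zero_le_one) _)
    (fun _ => Set.indicator_le_self' (fun _ _ => zero_le_one) _)]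
  congr 1
  ext c
  by_cases h : c = b <;> simp [h]

theorem jumpOp_tsum (r : ι → ℝ) (T : ι → S → S) {α : Type*} (f : α → S → ℝ≥0∞) (a : S) :
    jumpOp r T (fun b => ∑' i, f i b) a = ∑' i, jumpOp r T (f i) a := by
  simp only [jumpOp, ← ENNReal.tsum_mul_left]
  exact (Summable.tsum_finsetSum fun _ _ => ENNReal.summable).symm

theorem jumpOp_iterate_tsum (r : ι → ℝ) (T : ι → S → S) {α : Type*} (f : α → S → ℝ≥0∞) (k : ℕ)
    (a : S) : (jumpOp r T)^[k] (fun b => ∑' i, f i b) a = ∑' i, (jumpOp r T)^[k] (f i) a := by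
  induction k generalizing a with
  | zero => rfl
  | succ k ih =>
    simp only [Function.iterate_succ_apply']
    rw [← jumpOp_tsum]
    congr 1
    exact funext ih

theorem heat_tsum (r : ι → ℝ) (T : ι → S → S) (t : ℝ≥0) {α : Type*} (f : α → S → ℝ≥0∞) (a : S) :
    heat r T t (fun b => ∑' i, f i b) a = ∑' i, heat r T t (f i) a := by
  simp only [heat, jumpOp_iterate_tsum, ← ENNReal.tsum_mul_left]
  exact ENNReal.tsum_comm

theorem jumpOp_const_mul (r : ι → ℝ) (T : ι → S → S) (c : ℝ≥0∞) (f : S → ℝ≥0∞) (a : S) :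
    jumpOp r T (fun b => c * f b) a = c * jumpOp r T f a := by
  simp only [jumpOp, Finset.mul_sum]
  exact Finset.sum_congr rfl fun j _ => by ring

theorem jumpOp_iterate_const_mul (r : ι → ℝ) (T : ι → S → S) (c : ℝ≥0∞) (f : S → ℝ≥0∞) (k : ℕ)
    (a : S) : (jumpOp r T)^[k] (fun b => c * f b) a = c * (jumpOp r T)^[k] f a := by
  induction k generalizing a with
  | zero => rfl
  | succ k ih =>
    simp only [Function.iterate_succ_apply']
    rw [← jumpOp_const_mul]
    congr 1
    exact funext ih

theorem heat_const_mul (r : ι → ℝ) (T : ι → S → S) (t : ℝ≥0) (c : ℝ≥0∞) (f : S → ℝ≥0∞) (a : S) :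
    heat r T t (fun b => c * f b) a = c * heat r T t f a := by
  simp only [heat, jumpOp_iterate_const_mul, ← ENNReal.tsum_mul_left]
  exact tsum_congr fun k => by ring

theorem eq_tsum_mul_indicator (f : S → ℝ≥0∞) :
    f = fun a => ∑' b, f b * Set.indicator {b} 1 a := by
  ext a
  rw [tsum_eq_single a]
  · simp
  · intro b hb
    simp [hb.symm]

/-- Expand `f` in indicators of points: `heat` integrates against the transition probabilities. -/
theorem heat_eq_tsum (r : ι → ℝ) (T : ι → S → S) (t : ℝ≥0) (f : S → ℝ≥0∞) (a : S) :
    heat r T t f a = ∑' b, f b * heat r T t (Set.indicator {b} 1) a := by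
  conv_lhs => rw [eq_tsum_mul_indicator f]
  rw [heat_tsum]
  exact tsum_congr fun b => heat_const_mul r T t (f b) _ a

theorem jumpOp_iterate_one {r : ι → ℝ} (hr : ∀ j, 0 ≤ r j) (T : ι → S → S) (k : ℕ) (a : S) :
    (jumpOp r T)^[k] 1 a = ENNReal.ofReal (totalRate r) ^ k := by
  induction k generalizing a with
  | zero => rfl
  | succ k ih =>
    rw [Function.iterate_succ_apply', jumpOp]
    simp only [ih]
    rw [← Finset.sum_mul, ← ENNReal.ofReal_sum_of_nonneg fun j _ => hr j, pow_succ', totalRate]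

theorem totalRate_nonneg {r : ι → ℝ} (hr : ∀ j, 0 ≤ r j) : 0 ≤ totalRate r :=
  Finset.sum_nonneg fun j _ => hr j

/-- These are the Poisson probabilities with mean `Λ t`. -/
theorem tsum_jumpWeight_mul {r : ι → ℝ} (hr : ∀ j, 0 ≤ r j) (t : ℝ≥0) :
    ∑' k, jumpWeight r t k * ENNReal.ofReal (totalRate r) ^ k = 1 := by
  have hΛ := totalRate_nonneg hr
  have : ∀ k, jumpWeight r t k * ENNReal.ofReal (totalRate r) ^ k =
      ENNReal.ofReal (Real.exp (-(totalRate r * t)) * ((totalRate r * t) ^ k / (k ! : ℝ))) := by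
    intro k
    rw [jumpWeight, ← ENNReal.ofReal_pow hΛ, ← ENNReal.ofReal_mul (by positivity), mul_pow]
    congr 1
    ring
  simp only [this]
  rw [← ENNReal.ofReal_tsum_of_nonneg (fun k => by positivity)
    ((Real.summable_pow_div_factorial _).mul_left _), tsum_mul_left]
  have hexp : Real.exp (totalRate r * t) = ∑' k : ℕ, (totalRate r * t) ^ k / (k ! : ℝ) := by
    rw [Real.exp_eq_exp_ℝ, NormedSpace.exp_eq_tsum_div]
  rw [← hexp, ← Real.exp_add]
  simp

theorem heat_one {r : ι → ℝ} (hr : ∀ j, 0 ≤ r j) (T : ι → S → S) (t : ℝ≥0) (a : S) :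
    heat r T t 1 a = 1 := by
  simp only [heat, jumpOp_iterate_one hr, tsum_jumpWeight_mul hr]

theorem jumpOp_iterate_comp {S' : Type*} (r : ι → ℝ) {T : ι → S → S} {T' : ι → S' → S'}
    {p : S → S'} (hp : ∀ j a, p (T j a) = T' j (p a)) (f : S' → ℝ≥0∞) (k : ℕ) (a : S) :
    (jumpOp r T)^[k] (fun b => f (p b)) a = (jumpOp r T')^[k] f (p a) := by
  induction k generalizing a with
  | zero => rfl
  | succ k ih => simp only [Function.iterate_succ_apply', jumpOp, ih, hp]

theorem heat_comp {S' : Type*} (r : ι → ℝ) {T : ι → S → S} {T' : ι → S' → S'}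
    {p : S → S'} (hp : ∀ j a, p (T j a) = T' j (p a)) (t : ℝ≥0) (f : S' → ℝ≥0∞) (a : S) :
    heat r T t (fun b => f (p b)) a = heat r T' t f (p a) := by
  simp only [heat, jumpOp_iterate_comp r hp]

/-- Under balance each application of the jump operator multiplies the integral by `Λ`, and the
resulting Poisson probabilities sum to one. -/
theorem tsum_mul_heat_of_balance {r : ι → ℝ} (hr : ∀ j, 0 ≤ r j) {T : ι → S → S} {π : S → ℝ≥0∞}
    (hπ : ∀ f : S → ℝ≥0∞,
      ∑' a, π a * jumpOp r T f a = ENNReal.ofReal (totalRate r) * ∑' a, π a * f a)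
    (t : ℝ≥0) (f : S → ℝ≥0∞) : ∑' a, π a * heat r T t f a = ∑' a, π a * f a := by
  have hk : ∀ k, ∑' a, π a * (jumpOp r T)^[k] f a =
      ENNReal.ofReal (totalRate r) ^ k * ∑' a, π a * f a := by
    intro k
    induction k with
    | zero => simp
    | succ k ih => simp only [Function.iterate_succ_apply', hπ, ih, pow_succ', mul_assoc]
  simp only [heat, ← ENNReal.tsum_mul_left]
  rw [ENNReal.tsum_comm]
  have : ∀ k, ∑' a, π a * (jumpWeight r t k * (jumpOp r T)^[k] f a) =
      jumpWeight r t k * ENNReal.ofReal (totalRate r) ^ k * ∑' a, π a * f a := by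
    intro k
    rw [mul_assoc, ← hk, ← ENNReal.tsum_mul_left]
    exact tsum_congr fun a => by ring
  simp only [this]
  rw [ENNReal.tsum_mul_right, tsum_jumpWeight_mul hr, one_mul]

/-- If a word of transitions leads from every state to `b`, then the transition probabilities to
`b` are bounded away from zero, uniformly in the initial state. -/
theorem exists_pos_le_heat {r : ι → ℝ} (hr : ∀ j, 0 < r j) (T : ι → S → S) {b : S}
    (w : List ι) {t : ℝ≥0} (ht : 0 < t) :
    ∃ δ : ℝ≥0∞, 0 < δ ∧ ∀ c, w.foldl (fun s j => T j s) c = b →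
      δ ≤ heat r T t (Set.indicator {b} 1) c := by
  -- Following the word contributes one term to the power of the jump operator; its value is the
  -- product of the rates along the word and does not depend on `c`.
  have hw : ∃ δ : ℝ≥0∞, 0 < δ ∧ ∀ c, w.foldl (fun s j => T j s) c = b →
      δ ≤ (jumpOp r T)^[w.length] (Set.indicator {b} 1) c := by
    clear ht
    induction w with
    | nil => exact ⟨1, one_pos, fun c hc => by simp_all⟩
    | cons j w ih =>
      obtain ⟨δ, hδ, h⟩ := ih
      refine ⟨ENNReal.ofReal (r j) * δ,
        ENNReal.mul_pos (ENNReal.ofReal_pos.mpr (hr j)).ne' hδ.ne', fun c hc => ?_⟩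
      rw [List.length_cons, Function.iterate_succ_apply', jumpOp]
      refine le_trans ?_ (Finset.single_le_sum
        (f := fun j => ENNReal.ofReal (r j) * (jumpOp r T)^[w.length] (Set.indicator {b} 1) (T j c))
        (fun _ _ => zero_le) (Finset.mem_univ j))
      gcongr
      exact h _ hc
  obtain ⟨δ, hδ, h⟩ := hw
  refine ⟨jumpWeight r t w.length * δ, ENNReal.mul_pos ?_ hδ.ne', fun c hc => ?_⟩
  · rw [jumpWeight]
    exact (ENNReal.ofReal_pos.mpr (by positivity)).ne'
  · refine le_trans ?_ (ENNReal.le_tsum w.length)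
    gcongr
    exact h c hc

end Heat

/-! ### Stationary distributions and the Doeblin bound. -/

section Stationary

variable {S ι : Type*} [Fintype ι]

theorem IsStationary.tsum_ofReal_mul_heat {r : ι → ℝ} (hr : ∀ j, 0 ≤ r j) {T : ι → S → S}
    {π : S → ℝ} (hπ : IsStationary r T π) (t : ℝ≥0) (b : S) :
    ∑' a, ENNReal.ofReal (π a) * heat r T t (Set.indicator {b} 1) a = ENNReal.ofReal (π b) := by
  rw [← (hπ.invariant t b).tsum_eq, ENNReal.ofReal_tsum_of_nonneg
    (fun a => mul_nonneg (hπ.nonneg a) (transProb_nonneg hr T t a b)) (hπ.invariant t b).summable]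
  exact tsum_congr fun a => by rw [ENNReal.ofReal_mul (hπ.nonneg a), ofReal_transProb hr]

theorem IsStationary.tsum_ofReal {r : ι → ℝ} {T : ι → S → S} {π : S → ℝ}
    (hπ : IsStationary r T π) : ∑' a, ENNReal.ofReal (π a) = 1 := by
  rw [← ENNReal.ofReal_tsum_of_nonneg hπ.nonneg hπ.hasSum_one.summable, hπ.hasSum_one.tsum_eq,
    ENNReal.ofReal_one]

theorem isStationary_of_balance {r : ι → ℝ} (hr : ∀ j, 0 ≤ r j) {T : ι → S → S} {π : S → ℝ}
    (hπ0 : ∀ a, 0 ≤ π a) (hπ1 : ∑' a, ENNReal.ofReal (π a) = 1)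
    (hπ : ∀ f : S → ℝ≥0∞, ∑' a, ENNReal.ofReal (π a) * jumpOp r T f a =
      ENNReal.ofReal (totalRate r) * ∑' a, ENNReal.ofReal (π a) * f a) :
    IsStationary r T π := by
  have key : ∀ (g : S → ℝ) (c : ℝ), (∀ a, 0 ≤ g a) → 0 ≤ c →
      ∑' a, ENNReal.ofReal (g a) = ENNReal.ofReal c → HasSum g c := by
    intro g c hg hc h
    have h1 := ENNReal.hasSum_toReal (f := fun a => ENNReal.ofReal (g a))
      (by rw [h]; exact ENNReal.ofReal_ne_top)
    rw [← ENNReal.tsum_toReal_eq (fun a => ENNReal.ofReal_ne_top), h,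
      ENNReal.toReal_ofReal hc] at h1
    simpa only [ENNReal.toReal_ofReal (hg _)] using h1
  refine ⟨hπ0, key _ _ hπ0 zero_le_one (by simpa using hπ1), fun t b => ?_⟩
  refine key _ _ (fun a => mul_nonneg (hπ0 a) (transProb_nonneg hr T t a b)) (hπ0 b) ?_
  have h := tsum_mul_heat_of_balance hr hπ t (Set.indicator {b} 1)
  have h' : ∑' a, ENNReal.ofReal (π a) * Set.indicator {b} 1 a = ENNReal.ofReal (π b) :=
    (tsum_eq_single b fun a ha => by simp [ha]).trans (by simp)
  rw [← h', ← h]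
  exact tsum_congr fun a => by rw [ENNReal.ofReal_mul (hπ0 a), ofReal_transProb hr]

/-- The minimum `m` of two invariant measures is mapped below itself, while mass is preserved, so
`m` is invariant too. Then `u - m` is carried to a measure without mass at `b₀`; as every state
reaches `b₀` with probability at least `δ`, it vanishes. -/
theorem le_of_invariant_of_le_at {r : ι → ℝ} (hr : ∀ j, 0 ≤ r j) {T : ι → S → S} {t : ℝ≥0}
    {u v : S → ℝ≥0∞}
    (hu : ∀ b, ∑' a, u a * heat r T t (Set.indicator {b} 1) a = u b)
    (hv : ∀ b, ∑' a, v a * heat r T t (Set.indicator {b} 1) a = v b)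
    (hufin : ∑' a, u a ≠ ∞) {b₀ : S} {δ : ℝ≥0∞} (hδ : 0 < δ)
    (hD : ∀ c, δ ≤ heat r T t (Set.indicator {b₀} 1) c) (h₀ : u b₀ ≤ v b₀) (a : S) :
    u a ≤ v a := by
  set m : S → ℝ≥0∞ := fun a => min (u a) (v a) with hm
  have hmu : ∀ a, m a ≤ u a := fun a => min_le_left _ _
  have hmfin : ∑' a, m a ≠ ∞ := ne_top_of_le_ne_top hufin (ENNReal.tsum_le_tsum hmu)
  have hmle : ∀ b, ∑' a, m a * heat r T t (Set.indicator {b} 1) a ≤ m b := fun b =>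
    le_min
      ((ENNReal.tsum_le_tsum fun a => by gcongr; exact min_le_left _ _).trans_eq (hu b))
      ((ENNReal.tsum_le_tsum fun a => by gcongr; exact min_le_right _ _).trans_eq (hv b))
  have htot : ∑' b, ∑' a, m a * heat r T t (Set.indicator {b} 1) a = ∑' a, m a := by
    rw [ENNReal.tsum_comm]
    refine tsum_congr fun a => ?_
    have := heat_eq_tsum r T t 1 a
    simp only [Pi.one_apply, one_mul] at this
    rw [ENNReal.tsum_mul_left, ← this, heat_one hr, mul_one]
  -- A strict inequality at one point would make the finite total masses in `htot` differ.
  have hminv : ∀ b, ∑' a, m a * heat r T t (Set.indicator {b} 1) a = m b := by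
    intro b
    by_contra hne
    have := ENNReal.tsum_lt_tsum (htot ▸ hmfin) hmle (lt_of_le_of_ne (hmle b) hne)
    exact this.ne htot
  have hmb : m b₀ ≠ ∞ := ENNReal.ne_top_of_tsum_ne_top hmfin b₀
  have hdiff : ∑' a, (u a - m a) * heat r T t (Set.indicator {b₀} 1) a = 0 := by
    have h1 : ∑' a, (u a - m a) * heat r T t (Set.indicator {b₀} 1) a + m b₀ = 0 + m b₀ := by
      conv_lhs => rw [← hminv b₀]
      rw [← ENNReal.tsum_add, zero_add, hm]
      simp only [min_eq_left h₀]
      rw [← hu b₀]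
      refine tsum_congr fun a => ?_
      rw [← add_mul, tsub_add_cancel_of_le (hmu a)]
    exact (ENNReal.add_left_inj hmb).mp h1
  have := ENNReal.tsum_eq_zero.mp hdiff a
  rw [mul_eq_zero, or_iff_left (hδ.trans_le (hD a)).ne', tsub_eq_zero_iff_le] at this
  exact this.trans (min_le_right _ _)

/-- Two laws are always comparable at `b₀`. The comparison extends to all states by
`le_of_invariant_of_le_at`, and equal total masses turn it into equality. -/
theorem IsStationary.eq_of_reset {r : ι → ℝ} (hr : ∀ j, 0 < r j) {T : ι → S → S} {b₀ : S}
    {w : List ι} (hw : ∀ c, w.foldl (fun s j => T j s) c = b₀) {π π' : S → ℝ}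
    (hπ : IsStationary r T π) (hπ' : IsStationary r T π') : π = π' := by
  have hr0 : ∀ j, 0 ≤ r j := fun j => (hr j).le
  obtain ⟨δ, hδ, hD⟩ := exists_pos_le_heat hr T (b := b₀) w (t := 1) one_pos
  have main : ∀ {ρ ρ' : S → ℝ}, IsStationary r T ρ → IsStationary r T ρ' → ρ b₀ ≤ ρ' b₀ →
      ρ = ρ' := by
    intro ρ ρ' h h' hle
    have hall := le_of_invariant_of_le_at hr0 (h.tsum_ofReal_mul_heat hr0 1)
      (h'.tsum_ofReal_mul_heat hr0 1) (by rw [h.tsum_ofReal]; exact ENNReal.one_ne_top) hδ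
      (fun c => hD c (hw c)) (ENNReal.ofReal_le_ofReal hle)
    ext a
    by_contra hne
    have hlt : ENNReal.ofReal (ρ a) < ENNReal.ofReal (ρ' a) := by
      refine lt_of_le_of_ne (hall a) fun heq => hne ?_
      exact (ENNReal.ofReal_eq_ofReal_iff (h.nonneg a) (h'.nonneg a)).mp heq
    have := ENNReal.tsum_lt_tsum (by rw [h.tsum_ofReal]; exact ENNReal.one_ne_top) hall hlt
    rw [h.tsum_ofReal, h'.tsum_ofReal] at this
    exact lt_irrefl _ this
  rcases le_total (π b₀) (π' b₀) with h | h
  · exact main hπ hπ' h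
  · exact (main hπ' hπ h).symm

theorem isIrreducibleChain_of_reset {r : ι → ℝ} (hr : ∀ j, 0 < r j) {T : ι → S → S}
    (hT : ∀ b, ∃ w : List ι, ∀ c, w.foldl (fun s j => T j s) c = b) : IsIrreducibleChain r T := by
  intro a b
  obtain ⟨w, hw⟩ := hT b
  obtain ⟨δ, hδ, hD⟩ := exists_pos_le_heat hr T (b := b) w (t := 1) one_pos
  refine ⟨1, ENNReal.ofReal_pos.mp ?_⟩
  rw [ofReal_transProb fun j => (hr j).le]
  exact hδ.trans_le (hD a (hw a))

end Stationary

/-- Time is cut into blocks of length two. In a successful block the path is at `b ≠ a` halfway and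
at `a` at the end, so it has left `a` and come back. Block `k` costs 2 if all earlier blocks failed.
-/
theorem returnTime_le_tsum {S : Type*} (a b : S) (hab : b ≠ a) (path : ℝ≥0 → S) :
    returnTime a path ≤ ∑' k : ℕ, {k : ℕ | ∀ i < k,
      ¬ (path (2 * i + 1) = b ∧ path (2 * i + 1 + 1) = a)}.indicator (fun _ => 2) k := by
  classical
  by_cases h : ∃ i : ℕ, path (2 * i + 1) = b ∧ path (2 * i + 1 + 1) = a
  · have hi := Nat.find_spec h
    have hmin := fun j => Nat.find_min h (m := j)
    set i := Nat.find h
    have h1 : exitTime a path ≤ ((2 * i + 1 : ℝ≥0) : ℝ≥0∞) :=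
      iInf₂_le (2 * i + 1 : ℝ≥0) (by rw [hi.1]; exact hab)
    have h2 : returnTime a path ≤ ((2 * i + 1 + 1 : ℝ≥0) : ℝ≥0∞) :=
      iInf₂_le (2 * i + 1 + 1 : ℝ≥0) ⟨h1.trans (by gcongr; simp), hi.2⟩
    refine h2.trans (le_trans ?_ (ENNReal.sum_le_tsum (Finset.range (i + 1))))
    rw [Finset.sum_congr rfl (g := fun _ => (2 : ℝ≥0∞))]
    · simp only [Finset.sum_const, Finset.card_range, nsmul_eq_mul]
      push_cast
      apply le_of_eq
      ring
    · intro k hk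
      rw [Set.indicator_of_mem]
      intro j hj
      exact hmin j (hj.trans_le (Finset.mem_range_succ_iff.mp hk))
  -- Without any successful block the right-hand side is infinite.
  · push Not at h
    have : {k : ℕ | ∀ i < k, ¬ (path (2 * i + 1) = b ∧ path (2 * i + 1 + 1) = a)} = Set.univ := by
      ext k
      simp only [Set.mem_ofPred_eq, Set.mem_univ, iff_true, not_and]
      exact fun i _ => h i
    rw [this]
    simp

/-! ### Events of the past and the Markov property in `[0, ∞]`. -/

section Past

open MeasureTheory

variable {S Ω : Type*} [MeasurableSpace S]

/-- The events that depend only on the path up to time `s`. -/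
abbrev pastEvents (X : ℝ≥0 → Ω → S) (s : ℝ≥0) : MeasurableSpace Ω :=
  ⨆ u ∈ Set.Iic s, MeasurableSpace.comap (X u) inferInstance

theorem measurableSet_pastEvents (X : ℝ≥0 → Ω → S) {u s : ℝ≥0} (hus : u ≤ s) {B : Set S}
    (hB : MeasurableSet B) : MeasurableSet[pastEvents X s] (X u ⁻¹' B) := by
  have : MeasurableSpace.comap (X u) inferInstance ≤ pastEvents X s :=
    le_iSup₂_of_le u (Set.mem_Iic.mpr hus) le_rfl
  exact this _ ⟨B, hB, rfl⟩

theorem pastEvents_mono (X : ℝ≥0 → Ω → S) {s s' : ℝ≥0} (h : s ≤ s') :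
    pastEvents X s ≤ pastEvents X s' :=
  iSup₂_le fun u hu => le_iSup₂_of_le (f := fun u (_ : u ∈ Set.Iic s') =>
    MeasurableSpace.comap (X u) inferInstance) u (le_trans hu h) le_rfl

variable {ι : Type*} [Fintype ι] [MeasurableSpace Ω] {μ : Measure Ω} {r : ι → ℝ}
  {T : ι → S → S} {X : ℝ≥0 → Ω → S}

theorem IsMarkovChain.measure_inter (hr : ∀ j, 0 ≤ r j) (hX : IsMarkovChain r T μ X)
    (s t : ℝ≥0) {E : Set Ω} (hE : MeasurableSet[pastEvents X s] E) (a b : S) :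
    μ (E ∩ X s ⁻¹' {a} ∩ X (s + t) ⁻¹' {b}) =
      μ (E ∩ X s ⁻¹' {a}) * heat r T t (Set.indicator {b} 1) a := by
  have := hX.isProbabilityMeasure
  have h := congrArg ENNReal.ofReal (hX.markov s t E hE a b)
  rw [ENNReal.ofReal_mul measureReal_nonneg, ofReal_transProb hr, ofReal_measureReal,
    ofReal_measureReal] at h
  exact h

end Past

/-! ### Images of Markov chains under intertwining maps, and positive recurrence. -/

section Markov

open MeasureTheory

variable {S ι : Type*} [Fintype ι] [MeasurableSpace S] [Countable S] [MeasurableSingletonClass S]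
  {Ω : Type*} [MeasurableSpace Ω] {μ : Measure Ω}

theorem measure_inter_preimage_eq_tsum {Y : Ω → S} (hY : Measurable Y) (F : Set Ω) (B : Set S) :
    μ (F ∩ Y ⁻¹' B) = ∑' b, B.indicator 1 b * μ (F ∩ Y ⁻¹' {b}) := by
  have hB : ∀ C : Set S, MeasurableSet C := fun C => C.to_countable.measurableSet
  have h : ∀ C : Set S, μ (F ∩ Y ⁻¹' C) = (μ.restrict F).map Y C := fun C => by
    rw [Measure.map_apply hY (hB C), Measure.restrict_apply (hY (hB C)), Set.inter_comm]
  simp only [h]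
  rw [← Measure.tsum_indicator_apply_singleton _ B (hB B)]
  refine tsum_congr fun b => ?_
  by_cases hb : b ∈ B <;> simp [hb]

theorem measure_eq_tsum_inter_preimage {Y : Ω → S} (hY : Measurable Y) (F : Set Ω) :
    μ F = ∑' b, μ (F ∩ Y ⁻¹' {b}) := by
  simpa using measure_inter_preimage_eq_tsum (μ := μ) hY F Set.univ

variable {r : ι → ℝ} {T : ι → S → S} {X : ℝ≥0 → Ω → S}

theorem IsMarkovChain.measure_inter_preimage (hr : ∀ j, 0 ≤ r j) (hX : IsMarkovChain r T μ X)
    (s t : ℝ≥0) {E : Set Ω} (hE : MeasurableSet[pastEvents X s] E) (a : S) (B : Set S) :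
    μ (E ∩ X s ⁻¹' {a} ∩ X (s + t) ⁻¹' B) =
      μ (E ∩ X s ⁻¹' {a}) * heat r T t (B.indicator 1) a := by
  rw [measure_inter_preimage_eq_tsum (hX.measurable _), heat_eq_tsum, ← ENNReal.tsum_mul_left]
  refine tsum_congr fun b => ?_
  rw [hX.measure_inter hr s t hE]
  ring

/-- A function of a Markov chain that intertwines the transitions is a Markov chain. -/
theorem IsMarkovChain.comp_of_intertwine {S' : Type*} [MeasurableSpace S'] [Countable S']
    [MeasurableSingletonClass S'] (hr : ∀ j, 0 ≤ r j) (hX : IsMarkovChain r T μ X)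
    {T' : ι → S' → S'} {p : S → S'} (hp : ∀ j a, p (T j a) = T' j (p a)) :
    IsMarkovChain r T' μ (fun t ω => p (X t ω)) := by
  have hpm : Measurable p := Measurable.of_discrete
  have := hX.isProbabilityMeasure
  refine ⟨hX.isProbabilityMeasure, fun t => hpm.comp (hX.measurable t), ?_, ?_⟩
  · filter_upwards [hX.rightContinuous] with ω hω t
    obtain ⟨ε, hε, h⟩ := hω t
    exact ⟨ε, hε, fun u h1 h2 => congrArg p (h u h1 h2)⟩
  · intro s t E hE a b
    have hE' : MeasurableSet[pastEvents X s] E := by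
      refine (iSup₂_le fun u hu => ?_ : _ ≤ pastEvents X s) E hE
      rintro _ ⟨B, hB, rfl⟩
      exact measurableSet_pastEvents X hu (hpm hB)
    have hset : ∀ (u : ℝ≥0) (d : S'), {ω | p (X u ω) = d} = X u ⁻¹' (p ⁻¹' {d}) := fun _ _ => rfl
    simp only [hset, measureReal_def]
    rw [← ENNReal.toReal_ofReal (transProb_nonneg hr T' t a b), ofReal_transProb hr,
      ← ENNReal.toReal_mul]
    congr 1
    -- Split according to the state `c` in the fibre over `a`; the probability of moving to the
    -- fibre over `b` depends only on `p c`.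
    rw [Set.inter_right_comm, measure_inter_preimage_eq_tsum (hX.measurable s),
      measure_inter_preimage_eq_tsum (hX.measurable s), ← ENNReal.tsum_mul_right]
    refine tsum_congr fun c => ?_
    rw [Set.inter_right_comm, hX.measure_inter_preimage hr s t hE']
    by_cases hc : p c = a
    · have : heat r T t ((p ⁻¹' {b}).indicator 1) c = heat r T' t (Set.indicator {b} 1) (p c) :=
        heat_comp r hp t (Set.indicator {b} 1) c
      rw [this, hc]
      ring
    · simp [hc]

/-- Whatever the state at its beginning, a block of length two succeeds with conditional probability
at least `δb * δa`. The number of failed blocks thus has a geometric tail, and `returnTime_le_tsum`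
bounds the expectation by a convergent geometric series. -/
theorem isPositiveRecurrent_of_reset [Nontrivial S] (hr : ∀ j, 0 < r j)
    (hT : ∀ b, ∃ w : List ι, ∀ c, w.foldl (fun s j => T j s) c = b) : IsPositiveRecurrent r T := by
  intro a Ω _ μ X hX _
  have hr0 : ∀ j, 0 ≤ r j := fun j => (hr j).le
  have := hX.isProbabilityMeasure
  obtain ⟨b, hba⟩ := exists_ne a
  obtain ⟨wa, hwa⟩ := hT a
  obtain ⟨wb, hwb⟩ := hT b
  obtain ⟨δa, hδa, hDa⟩ := exists_pos_le_heat hr T (b := a) wa (t := 1) one_pos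
  obtain ⟨δb, hδb, hDb⟩ := exists_pos_le_heat hr T (b := b) wb (t := 1) one_pos
  set G : ℕ → Set Ω := fun k => {ω | ∀ i < k,
      ¬ (X (2 * i + 1) ω = b ∧ X (2 * i + 1 + 1) ω = a)} with hG
  have hGsucc : ∀ k, G (k + 1) =
      G k \ (G k ∩ X (2 * k + 1) ⁻¹' {b} ∩ X (2 * k + 1 + 1) ⁻¹' {a}) := by
    intro k
    ext ω
    simp only [hG, Set.mem_ofPred_eq, Nat.lt_succ_iff_lt_or_eq, Set.mem_sdiff, Set.mem_inter_iff,
      Set.mem_preimage, Set.mem_singleton_iff]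
    constructor
    · intro h
      exact ⟨fun i hi => h i (Or.inl hi), fun h' => h k (Or.inr rfl) ⟨h'.1.2, h'.2⟩⟩
    · rintro ⟨h1, h2⟩ i (hi | rfl)
      · exact h1 i hi
      · exact fun h' => h2 ⟨⟨h1, h'.1⟩, h'.2⟩
  have hmeas : ∀ k : ℕ, MeasurableSet[pastEvents X (2 * k)] (G k) := by
    intro k
    induction k with
    | zero =>
      have : G 0 = Set.univ := by simp [hG]
      rw [this]
      exact MeasurableSet.univ
    | succ k ih =>
      have hle : pastEvents X (2 * k) ≤ pastEvents X (2 * (k + 1 : ℕ)) :=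
        pastEvents_mono X (by push_cast; gcongr; simp)
      rw [hGsucc]
      refine (hle _ ih).diff (((hle _ ih).inter ?_).inter ?_)
      · refine measurableSet_pastEvents X ?_ (measurableSet_singleton b)
        push_cast
        rw [mul_add]
        gcongr
        norm_num
      · refine measurableSet_pastEvents X ?_ (measurableSet_singleton a)
        push_cast
        rw [mul_add, add_assoc]
        gcongr
        norm_num
  have hpast : ∀ s, pastEvents X s ≤ ‹MeasurableSpace Ω› := fun s =>
    iSup₂_le fun u _ => (hX.measurable u).comap_le
  have hdecay : ∀ k, μ (G (k + 1)) ≤ (1 - δb * δa) * μ (G k) := by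
    intro k
    have hGm := hpast _ _ (hmeas k)
    -- The second half of the block uses the Markov property at `2 * k + 1`; the first half uses it
    -- at `2 * k`, summed over the state `c` there, with a bound uniform in `c`.
    have h1 : μ (G k ∩ X (2 * k + 1) ⁻¹' {b} ∩ X (2 * k + 1 + 1) ⁻¹' {a}) ≥
        δb * δa * μ (G k) := by
      rw [hX.measure_inter hr0 _ _ (pastEvents_mono X le_self_add _ (hmeas k)),
        measure_eq_tsum_inter_preimage (hX.measurable (2 * k)),
        measure_eq_tsum_inter_preimage (μ := μ) (hX.measurable (2 * k)) (G k), mul_right_comm]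
      refine mul_le_mul' ?_ (hDa b (hwa b))
      rw [← ENNReal.tsum_mul_left]
      refine ENNReal.tsum_le_tsum fun c => ?_
      rw [Set.inter_right_comm, hX.measure_inter hr0 _ _ (hmeas k), mul_comm]
      gcongr
      exact hDb c (hwb c)
    rw [hGsucc, measure_sdiff (Set.inter_subset_left.trans Set.inter_subset_left),
      ENNReal.sub_mul, one_mul]
    · exact tsub_le_tsub_left h1 _
    · exact fun _ _ => measure_ne_top _ _
    · exact ((hGm.inter (hX.measurable _ (measurableSet_singleton b))).inter
        (hX.measurable _ (measurableSet_singleton a))).nullMeasurableSet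
    · exact measure_ne_top _ _
  have hpow : ∀ k, μ (G k) ≤ (1 - δb * δa) ^ k := by
    intro k
    induction k with
    | zero => simpa using prob_le_one
    | succ k ih =>
      refine (hdecay k).trans ?_
      rw [pow_succ']
      gcongr
  calc ∫⁻ ω, returnTime a (fun t => X t ω) ∂μ
      ≤ ∫⁻ ω, ∑' k : ℕ, (G k).indicator (fun _ => 2) ω ∂μ := by
        refine lintegral_mono fun ω => (returnTime_le_tsum a b hba _).trans_eq ?_
        exact tsum_congr fun k => rfl
    _ = ∑' k : ℕ, 2 * μ (G k) := by
        rw [lintegral_tsum fun k =>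
          (measurable_const.indicator (hpast _ _ (hmeas k))).aemeasurable]
        exact tsum_congr fun k => lintegral_indicator_const (hpast _ _ (hmeas k)) _
    _ ≤ ∑' k : ℕ, 2 * (1 - δb * δa) ^ k :=
        ENNReal.tsum_le_tsum fun k => by gcongr; exact hpow k
    _ < ∞ := by
        rw [ENNReal.tsum_mul_left, ENNReal.tsum_geometric]
        refine ENNReal.mul_lt_top (by simp) (ENNReal.inv_lt_top.mpr ?_)
        rw [tsub_pos_iff_lt]
        exact ENNReal.sub_lt_self ENNReal.one_ne_top one_ne_zero
          (ENNReal.mul_pos hδb.ne' hδa.ne').ne'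

end Markov

/-! ### Finite-dimensional distributions determine the law. -/

section Law

open MeasureTheory

/-- Finite measures on a product of copies of a countable set are determined by the values on
cylinders over finite sets of indices that contain a given one. -/
theorem ext_of_cylinders {J S : Type*} [MeasurableSpace S] [Countable S]
    [MeasurableSingletonClass S] {m₁ m₂ : Measure (J → S)} [IsFiniteMeasure m₁]
    [IsFiniteMeasure m₂] (I₀ : Finset J)
    (h : ∀ I : Finset J, I₀ ⊆ I → ∀ c : J → S,
      m₁ {f | ∀ u ∈ I, f u = c u} = m₂ {f | ∀ u ∈ I, f u = c u}) : m₁ = m₂ := by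
  classical
  -- The point `c₀` extends assignments on `I` to all of `J`; its values off `I` do not matter.
  rcases isEmpty_or_nonempty (J → S) with hE | ⟨⟨c₀⟩⟩
  · exact Measure.ext fun s _ => by simp [Set.eq_empty_of_isEmpty s]
  have hI : ∀ I : Finset J, I₀ ⊆ I → m₁.map I.restrict = m₂.map I.restrict := by
    intro I hI₀
    refine Measure.ext_of_singleton fun d => ?_
    have hpre : (I.restrict : (J → S) → (I → S)) ⁻¹' {d} =
        {f | ∀ u ∈ I, f u = (fun u => if hu : u ∈ I then d ⟨u, hu⟩ else c₀ u) u} := by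
      ext f
      simp only [Set.mem_preimage, Set.mem_singleton_iff, Set.mem_ofPred_eq, funext_iff,
        Finset.restrict, Subtype.forall]
      exact forall₂_congr fun u hu => by simp [hu]
    rw [Measure.map_apply (Finset.measurable_restrict I) (measurableSet_singleton d),
      Measure.map_apply (Finset.measurable_restrict I) (measurableSet_singleton d), hpre, h I hI₀]
  refine IsProjectiveLimit.unique (P := fun I => m₁.map I.restrict) (fun I => rfl) fun I => ?_
  -- The marginal on an arbitrary `I` is a projection of the one on `I ∪ I₀`, where `hI` applies.
  have hsub : I ⊆ I ∪ I₀ := Finset.subset_union_left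
  have h2 := congrArg (fun m => m.map (Finset.restrict₂ (π := fun _ => S) hsub))
    (hI (I ∪ I₀) Finset.subset_union_right)
  rw [Measure.map_map (Finset.measurable_restrict₂ hsub) (Finset.measurable_restrict _),
    Measure.map_map (Finset.measurable_restrict₂ hsub) (Finset.measurable_restrict _),
    Finset.restrict₂_comp_restrict] at h2
  exact h2.symm

variable {S ι : Type*} [Fintype ι] [MeasurableSpace S] [MeasurableSingletonClass S]
  {Ω Ω' : Type*} [MeasurableSpace Ω] [MeasurableSpace Ω'] {μ : Measure Ω} {μ' : Measure Ω'}
  {r : ι → ℝ} {T : ι → S → S} {X : ℝ≥0 → Ω → S} {Z : ℝ≥0 → Ω' → S}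

theorem measurableSet_eval_eq {J : Type*} (u : J) (b : S) :
    MeasurableSet {f : J → S | f u = b} := by
  have h : Measurable fun f : J → S => f u := measurable_pi_apply u
  exact h (measurableSet_singleton b)

theorem measurableSet_pi_cylinder {J : Type*} (I : Finset J) (c : J → S) :
    MeasurableSet {f : J → S | ∀ u ∈ I, f u = c u} := by
  have : {f : J → S | ∀ u ∈ I, f u = c u} = ⋂ u ∈ I, {f | f u = c u} := by
    ext f
    simp
  rw [this]
  exact Finset.measurableSet_biInter I fun u _ => measurableSet_eval_eq u (c u)

theorem measurableSet_pastEvents_cylinder {Ω : Type*} (X : ℝ≥0 → Ω → S) {I : Finset ℝ≥0} {s : ℝ≥0}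
    (hI : ∀ u ∈ I, u ≤ s) (c : ℝ≥0 → S) :
    MeasurableSet[pastEvents X s] {ω | ∀ u ∈ I, X u ω = c u} := by
  have : {ω | ∀ u ∈ I, X u ω = c u} = ⋂ u ∈ I, X u ⁻¹' {c u} := by
    ext ω
    simp
  rw [this]
  exact Finset.measurableSet_biInter I fun u hu =>
    measurableSet_pastEvents X (hI u hu) (measurableSet_singleton _)

/-- As `m` is the last time in `I`, the cylinder over `I` belongs to the past of `m` and fixes the
state there, so the Markov property appends a later time. -/
theorem IsMarkovChain.measure_cylinder_insert (hr : ∀ j, 0 ≤ r j) (hX : IsMarkovChain r T μ X)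
    {I : Finset ℝ≥0} {m u : ℝ≥0} (hm : m ∈ I) (hI : ∀ v ∈ I, v ≤ m) (hu : m ≤ u) (c : ℝ≥0 → S) :
    μ {ω | ∀ v ∈ insert u I, X v ω = c v} =
      μ {ω | ∀ v ∈ I, X v ω = c v} * heat r T (u - m) (Set.indicator {c u} 1) (c m) := by
  have hE : {ω | ∀ v ∈ I, X v ω = c v} ∩ X m ⁻¹' {c m} = {ω | ∀ v ∈ I, X v ω = c v} :=
    Set.inter_eq_left.mpr fun ω hω => hω m hm
  have hF : {ω | ∀ v ∈ insert u I, X v ω = c v} =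
      {ω | ∀ v ∈ I, X v ω = c v} ∩ X m ⁻¹' {c m} ∩ X (m + (u - m)) ⁻¹' {c u} := by
    rw [hE, add_tsub_cancel_of_le hu]
    ext ω
    simp [and_comm]
  rw [hF, hX.measure_inter hr m (u - m) (measurableSet_pastEvents_cylinder X hI c), hE]

/-- The law of a Markov chain is determined by the transitions and the initial law. -/
theorem IsMarkovChain.map_eq [Countable S] (hr : ∀ j, 0 ≤ r j) (hX : IsMarkovChain r T μ X)
    (hZ : IsMarkovChain r T μ' Z) (h0 : μ.map (X 0) = μ'.map (Z 0)) :
    μ.map (fun ω t => X t ω) = μ'.map (fun ω t => Z t ω) := by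
  have := hX.isProbabilityMeasure
  have := hZ.isProbabilityMeasure
  have hXm : Measurable fun ω t => X t ω := measurable_pi_lambda _ hX.measurable
  have hZm : Measurable fun ω t => Z t ω := measurable_pi_lambda _ hZ.measurable
  have hcyl : ∀ (I : Finset ℝ≥0) (c : ℝ≥0 → S),
      μ {ω | ∀ u ∈ insert 0 I, X u ω = c u} = μ' {ω | ∀ u ∈ insert 0 I, Z u ω = c u} := by
    intro I c
    -- Times are added in increasing order. Keeping `0` in the set makes the initial law the base
    -- case and guarantees a last earlier time.
    induction I using Finset.induction_on_max with
    | empty =>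
      have h := congrArg (fun m => m {c 0}) h0
      rw [Measure.map_apply (hX.measurable 0) (measurableSet_singleton _),
        Measure.map_apply (hZ.measurable 0) (measurableSet_singleton _)] at h
      simp only [insert_empty_eq, Finset.mem_singleton, forall_eq]
      exact h
    | insert u I hI ih =>
      set m := (insert 0 I).max' ⟨0, Finset.mem_insert_self _ _⟩ with hmdef
      have hm : m ∈ insert 0 I := Finset.max'_mem _ _
      have hle : ∀ v ∈ insert 0 I, v ≤ m := fun v hv => Finset.le_max' _ _ hv
      have hu : m ≤ u := by
        rcases Finset.mem_insert.mp hm with h | h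
        · rw [h]
          exact zero_le
        · exact (hI m h).le
      rw [Finset.insert_comm, hX.measure_cylinder_insert hr hm hle hu,
        hZ.measure_cylinder_insert hr hm hle hu, ih]
  have := Measure.isProbabilityMeasure_map (μ := μ) hXm.aemeasurable
  have := Measure.isProbabilityMeasure_map (μ := μ') hZm.aemeasurable
  refine ext_of_cylinders {0} fun I hI c => ?_
  have hmeas := measurableSet_pi_cylinder I c
  rw [Measure.map_apply hXm hmeas, Measure.map_apply hZm hmeas]
  have := hcyl I c
  rwa [Finset.insert_eq_self.mpr (Finset.singleton_subset_iff.mp hI)] at this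

end Law

/-! ### The exponential distribution: Laplace transform, lack of memory, convolution. -/

section ExpLaw

open MeasureTheory

/-- The exponential distribution with parameter `Λ`, on `ℝ≥0`. -/
def expLaw (Λ : ℝ) : Measure ℝ≥0 :=
  ((volume.restrict (Set.Ioi (0 : ℝ))).withDensity
    fun x => ENNReal.ofReal (Λ * Real.exp (-(Λ * x)))).map Real.toNNReal

theorem lintegral_expLaw (Λ : ℝ) {f : ℝ≥0 → ℝ≥0∞} (hf : Measurable f) :
    ∫⁻ ξ, f ξ ∂expLaw Λ =
      ∫⁻ x in Set.Ioi (0 : ℝ), ENNReal.ofReal (Λ * Real.exp (-(Λ * x))) * f x.toNNReal := by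
  rw [expLaw, lintegral_map hf measurable_real_toNNReal]
  exact lintegral_withDensity_eq_lintegral_mul _ (by fun_prop) (hf.comp measurable_real_toNNReal)

theorem setLIntegral_exp_density {Λ : ℝ} (hΛ : 0 < Λ) :
    ∫⁻ x in Set.Ioi (0 : ℝ), ENNReal.ofReal (Λ * Real.exp (-(Λ * x))) = 1 := by
  rw [← ProbabilityTheory.lintegral_exponentialPDF_eq_one hΛ,
    ← lintegral_add_compl (ProbabilityTheory.exponentialPDF Λ)
      (measurableSet_Ioi (a := (0 : ℝ))), Set.compl_Ioi]
  have h0 : ∫⁻ x in Set.Iic (0 : ℝ), ProbabilityTheory.exponentialPDF Λ x = 0 := by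
    rw [setLIntegral_congr Iio_ae_eq_Iic.symm]
    exact ProbabilityTheory.lintegral_exponentialPDF_of_nonpos le_rfl
  rw [h0, add_zero]
  refine setLIntegral_congr_fun measurableSet_Ioi fun x hx => ?_
  rw [ProbabilityTheory.exponentialPDF_of_nonneg (le_of_lt hx)]

theorem isProbabilityMeasure_expLaw {Λ : ℝ} (hΛ : 0 < Λ) : IsProbabilityMeasure (expLaw Λ) := by
  refine ⟨?_⟩
  have := lintegral_expLaw Λ (f := 1) measurable_const
  simpa [setLIntegral_exp_density hΛ] using this

/-- The Laplace transform at 1 is `Λ / (Λ + 1)`. It becomes the contraction constant of the renewal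
equation. -/
theorem lintegral_exp_neg_expLaw_lt_one {Λ : ℝ} (hΛ : 0 < Λ) :
    ∫⁻ ξ, ENNReal.ofReal (Real.exp (-(ξ : ℝ))) ∂expLaw Λ < 1 := by
  rw [lintegral_expLaw Λ (by fun_prop)]
  have h : ∀ x ∈ Set.Ioi (0 : ℝ), ENNReal.ofReal (Λ * Real.exp (-(Λ * x))) *
      ENNReal.ofReal (Real.exp (-(x.toNNReal : ℝ))) =
      ENNReal.ofReal (Λ / (Λ + 1)) *
        ENNReal.ofReal ((Λ + 1) * Real.exp (-((Λ + 1) * x))) := by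
    intro x hx
    rw [Real.coe_toNNReal _ (le_of_lt hx), ← ENNReal.ofReal_mul (by positivity),
      ← ENNReal.ofReal_mul (by positivity)]
    congr 1
    have h1 : Real.exp (-((Λ + 1) * x)) = Real.exp (-(Λ * x)) * Real.exp (-x) := by
      rw [← Real.exp_add]
      congr 1
      ring
    rw [h1]
    field_simp
  rw [setLIntegral_congr_fun measurableSet_Ioi h, lintegral_const_mul _ (by fun_prop),
    setLIntegral_exp_density (by positivity), mul_one, ENNReal.ofReal_lt_one,
    div_lt_one (by positivity)]
  linarith

/-- Translating the integration variable by `s` multiplies the density by `exp (-Λ s)`. -/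
theorem lintegral_expLaw_memoryless (Λ : ℝ) (s : ℝ≥0) {f : ℝ≥0 → ℝ≥0∞} (hf : Measurable f) :
    ∫⁻ ξ, (if s < ξ then f (ξ - s) else 0) ∂expLaw Λ =
      ENNReal.ofReal (Real.exp (-(Λ * s))) * ∫⁻ ξ, f ξ ∂expLaw Λ := by
  have hm : Measurable fun ξ : ℝ≥0 => if s < ξ then f (ξ - s) else 0 :=
    Measurable.ite measurableSet_Ioi (hf.comp (measurable_id.sub_const s)) measurable_const
  rw [lintegral_expLaw Λ hm, lintegral_expLaw Λ hf, ← lintegral_const_mul _ (by fun_prop),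
    ← lintegral_indicator measurableSet_Ioi, ← lintegral_indicator measurableSet_Ioi,
    ← lintegral_add_right_eq_self _ (s : ℝ)]
  refine lintegral_congr fun x => ?_
  by_cases hx : 0 < x
  · have h1 : 0 < x + s := add_pos_of_pos_of_nonneg hx s.coe_nonneg
    rw [Set.indicator_of_mem (Set.mem_Ioi.mpr h1), Set.indicator_of_mem (Set.mem_Ioi.mpr hx)]
    have h2 : (x + s).toNNReal = x.toNNReal + s := by
      rw [Real.toNNReal_add hx.le s.coe_nonneg, Real.toNNReal_coe]
    rw [h2, if_pos (lt_add_of_pos_left s (Real.toNNReal_pos.mpr hx)), add_tsub_cancel_right,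
      ← mul_assoc, ← ENNReal.ofReal_mul (Real.exp_nonneg _)]
    congr 2
    rw [mul_add, neg_add, Real.exp_add]
    ring
  · rw [Set.indicator_of_notMem (s := Set.Ioi (0 : ℝ)) (a := x) hx]
    by_cases h1 : 0 < x + s
    · have h2 : ¬ s < (x + s).toNNReal := by
        rw [not_lt, Real.toNNReal_le_iff_le_coe]
        linarith
      rw [Set.indicator_of_mem (Set.mem_Ioi.mpr h1), if_neg h2, mul_zero]
    · exact Set.indicator_of_notMem h1 _

theorem integral_sub_pow_div_factorial (s : ℝ) (k : ℕ) :
    ∫ x in (0 : ℝ)..s, (s - x) ^ k / (k ! : ℝ) = s ^ (k + 1) / ((k + 1)! : ℝ) := by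
  rw [intervalIntegral.integral_comp_sub_left (fun x => x ^ k / (k ! : ℝ)), sub_self, sub_zero,
    intervalIntegral.integral_div, integral_pow, Nat.factorial_succ]
  push_cast
  field_simp
  ring

/-- First waiting time, then `k` transitions in the remaining time: the exponentials multiply to
`exp (-Λ s)`, which leaves the integral of `(s - x) ^ k / k!`. -/
theorem lintegral_jumpWeight_sub {ι : Type*} [Fintype ι] {r : ι → ℝ} (hr : 0 ≤ totalRate r)
    (s : ℝ≥0) (k : ℕ) :
    ∫⁻ ξ, (if ξ ≤ s then jumpWeight r (s - ξ) k else 0) ∂expLaw (totalRate r) =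
      ENNReal.ofReal (totalRate r) * jumpWeight r s (k + 1) := by
  set Λ := totalRate r with hΛ
  have hjw : Measurable fun t : ℝ≥0 => jumpWeight r t k := by
    unfold jumpWeight
    fun_prop
  have hm : Measurable fun ξ : ℝ≥0 => if ξ ≤ s then jumpWeight r (s - ξ) k else 0 :=
    Measurable.ite measurableSet_Iic (hjw.comp (measurable_id.const_sub s)) measurable_const
  have hI : ∫⁻ x in Set.Ioc (0 : ℝ) s, ENNReal.ofReal ((s - x) ^ k / (k ! : ℝ)) =
      ENNReal.ofReal ((s : ℝ) ^ (k + 1) / ((k + 1)! : ℝ)) := by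
    rw [← integral_sub_pow_div_factorial, intervalIntegral.integral_of_le s.coe_nonneg,
      ofReal_integral_eq_lintegral_ofReal]
    · exact (Continuous.integrableOn_Ioc (by fun_prop))
    · refine (ae_restrict_iff' measurableSet_Ioc).mpr (Filter.Eventually.of_forall fun x hx => ?_)
      have := sub_nonneg.mpr hx.2
      simp only [Pi.zero_apply]
      positivity
  rw [lintegral_expLaw Λ hm, jumpWeight, ENNReal.ofReal_mul (Real.exp_nonneg _), ← mul_assoc,
    ← ENNReal.ofReal_mul hr, ← hI, ← lintegral_const_mul _ (by fun_prop),
    ← lintegral_indicator measurableSet_Ioi, ← lintegral_indicator measurableSet_Ioc]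
  refine lintegral_congr fun x => ?_
  by_cases hx : 0 < x
  · rw [Set.indicator_of_mem (Set.mem_Ioi.mpr hx)]
    by_cases hxs : x ≤ s
    · have h1 : x.toNNReal ≤ s := Real.toNNReal_le_iff_le_coe.mpr hxs
      have h2 := sub_nonneg.mpr hxs
      rw [Set.indicator_of_mem (Set.mem_Ioc.mpr ⟨hx, hxs⟩), if_pos h1, jumpWeight,
        NNReal.coe_sub h1, Real.coe_toNNReal _ hx.le, ← ENNReal.ofReal_mul (by positivity),
        ← ENNReal.ofReal_mul (by positivity)]
      congr 1
      rw [← mul_assoc, mul_assoc Λ, ← Real.exp_add]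
      congr 3
      ring
    · have h1 : ¬ x.toNNReal ≤ s := fun h => hxs (Real.toNNReal_le_iff_le_coe.mp h)
      rw [if_neg h1, mul_zero, Set.indicator_of_notMem fun h => hxs h.2]
  · rw [Set.indicator_of_notMem (s := Set.Ioi (0 : ℝ)) (a := x) hx,
      Set.indicator_of_notMem fun h => hx h.1]

end ExpLaw

/-! ### Splitting off the first term of an i.i.d. sequence. -/

section ConsSeq

open MeasureTheory

variable {E : Type*}

/-- The sequence with first term `p.1` and remaining terms `p.2`. -/
def consSeq (p : E × (ℕ → E)) : ℕ → E
  | 0 => p.1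
  | k + 1 => p.2 k

theorem measurable_consSeq [MeasurableSpace E] :
    Measurable (consSeq : E × (ℕ → E) → (ℕ → E)) := by
  refine measurable_pi_lambda _ fun k => ?_
  cases k with
  | zero => exact measurable_fst
  | succ k => exact (measurable_pi_apply k).comp measurable_snd

/-- Putting an independent term in front of an i.i.d. sequence preserves its law; this is what
permits conditioning on the first transition. -/
theorem map_consSeq_infinitePi [MeasurableSpace E] (ρ : Measure E) [IsProbabilityMeasure ρ] :
    (ρ.prod (Measure.infinitePi fun _ : ℕ => ρ)).map consSeq =
      Measure.infinitePi fun _ : ℕ => ρ := by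
  classical
  refine Measure.eq_infinitePi _ fun s t ht => ?_
  obtain ⟨N, hN⟩ : ∃ N, s ⊆ Finset.range (N + 1) :=
    ⟨s.sup id, fun i hi => Finset.mem_range_succ_iff.mpr (Finset.le_sup (f := id) hi)⟩
  -- Filling the box with `Set.univ` off `s` makes it a box over an initial segment, where the first
  -- factor can be separated.
  set t' : ℕ → Set E := fun i => if i ∈ s then t i else Set.univ with ht'
  have ht'm : ∀ i, MeasurableSet (t' i) := fun i => by
    simp only [ht']
    split_ifs
    exacts [ht i, MeasurableSet.univ]
  have hpre : consSeq ⁻¹' (Set.pi s t) =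
      t' 0 ×ˢ Set.pi (Finset.range N : Set ℕ) fun i => t' (i + 1) := by
    ext ⟨e, ω⟩
    have h1 : consSeq (e, ω) ∈ Set.pi s t ↔ ∀ i, consSeq (e, ω) i ∈ t' i := by
      refine forall_congr' fun i => ?_
      by_cases hi : i ∈ s <;> simp [ht', hi]
    simp only [Set.mem_preimage, h1, Set.mem_prod, Set.mem_pi, Finset.mem_coe, Finset.mem_range]
    constructor
    · exact fun h => ⟨h 0, fun i _ => h (i + 1)⟩
    · rintro ⟨h0, h⟩ (_ | i)
      · exact h0
      · by_cases hi : i < N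
        · exact h i hi
        · have : i + 1 ∉ s := fun hs => hi (by simpa using hN hs)
          simp [ht', this]
  rw [Measure.map_apply measurable_consSeq (MeasurableSet.pi s.countable_toSet fun i _ => ht i),
    hpre, Measure.prod_prod, Measure.infinitePi_pi _ fun i _ => ht'm _, mul_comm,
    ← Finset.prod_range_succ' fun i => ρ (t' i)]
  rw [← Finset.prod_subset hN]
  · exact Finset.prod_congr rfl fun i hi => by simp [ht', hi]
  · intro i _ hi
    simp [ht', hi]

theorem infinitePi_apply_eq_lintegral [MeasurableSpace E] (ρ : Measure E) [IsProbabilityMeasure ρ]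
    {A : Set (ℕ → E)} (hA : MeasurableSet A) :
    (Measure.infinitePi fun _ : ℕ => ρ) A =
      ∫⁻ e, (Measure.infinitePi fun _ : ℕ => ρ) {ω | consSeq (e, ω) ∈ A} ∂ρ := by
  conv_lhs => rw [← map_consSeq_infinitePi]
  rw [Measure.map_apply measurable_consSeq hA, Measure.prod_apply (measurable_consSeq hA)]
  rfl

end ConsSeq

/-! ### Paths driven by waiting times and marks, and the renewal equation. -/

section Construction

open MeasureTheory

variable {S ι : Type*}

/-- The time of the `k`-th transition, if the `i`-th entry of `ω` holds the waiting time for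
transition `i + 1`, and its kind. -/
def arrival : ℕ → (ℕ → ℝ≥0 × ι) → ℝ≥0
  | 0, _ => 0
  | k + 1, ω => (ω 0).1 + arrival k (fun i => ω (i + 1))

/-- The state after `k` transitions. -/
def embedded (T : ι → S → S) : ℕ → S → (ℕ → ℝ≥0 × ι) → S
  | 0, a, _ => a
  | k + 1, a, ω => embedded T k (T (ω 0).2 a) (fun i => ω (i + 1))

/-- The number of transitions up to time `t` (zero if there are infinitely many). -/
def jumpCount (t : ℝ≥0) (ω : ℕ → ℝ≥0 × ι) : ℕ := sInf {k | t < arrival (k + 1) ω}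

/-- The state at time `t`. -/
def chainPath (T : ι → S → S) (a : S) (t : ℝ≥0) (ω : ℕ → ℝ≥0 × ι) : S :=
  embedded T (jumpCount t ω) a ω

/-- There are only finitely many transitions in bounded intervals of time. -/
def NonExplosive (ω : ℕ → ℝ≥0 × ι) : Prop := ∀ t, ∃ k, t < arrival k ω

theorem NonExplosive.exists_succ {ω : ℕ → ℝ≥0 × ι} (h : NonExplosive ω) (t : ℝ≥0) :
    {k | t < arrival (k + 1) ω}.Nonempty := by
  obtain ⟨_ | k, hk⟩ := h t
  · exact absurd hk not_lt_zero
  · exact ⟨k, hk⟩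

theorem jumpCount_eq {t : ℝ≥0} {ω : ℕ → ℝ≥0 × ι} {k : ℕ} (h1 : t < arrival (k + 1) ω)
    (h2 : ∀ i < k, arrival (i + 1) ω ≤ t) : jumpCount t ω = k := by
  refine le_antisymm (Nat.sInf_le h1) ?_
  by_contra! hlt
  exact absurd (Nat.sInf_mem (s := {k | t < arrival (k + 1) ω}) ⟨k, h1⟩) (not_lt.mpr (h2 _ hlt))

theorem NonExplosive.lt_arrival {ω : ℕ → ℝ≥0 × ι} (h : NonExplosive ω) (t : ℝ≥0) :
    t < arrival (jumpCount t ω + 1) ω := Nat.sInf_mem (h.exists_succ t)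

theorem arrival_le_of_lt_jumpCount {ω : ℕ → ℝ≥0 × ι} {t : ℝ≥0} {i : ℕ}
    (hi : i < jumpCount t ω) : arrival (i + 1) ω ≤ t :=
  not_lt.mp fun h => Nat.notMem_of_lt_sInf hi h

theorem jumpCount_cons_of_lt {t : ℝ≥0} {e : ℝ≥0 × ι} (ω : ℕ → ℝ≥0 × ι) (h : t < e.1) :
    jumpCount t (consSeq (e, ω)) = 0 :=
  jumpCount_eq (by simpa [arrival, consSeq] using h) fun i hi => absurd hi (Nat.not_lt_zero i)

theorem NonExplosive.jumpCount_cons {t : ℝ≥0} {e : ℝ≥0 × ι} {ω : ℕ → ℝ≥0 × ι}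
    (hω : NonExplosive ω) (h : e.1 ≤ t) :
    jumpCount t (consSeq (e, ω)) = jumpCount (t - e.1) ω + 1 := by
  refine jumpCount_eq ?_ fun i hi => ?_
  · exact (tsub_lt_iff_left h).mp (hω.lt_arrival (t - e.1))
  · cases i with
    | zero => simpa [arrival, consSeq] using h
    | succ i =>
      exact (le_tsub_iff_left h).mp (arrival_le_of_lt_jumpCount (Nat.succ_lt_succ_iff.mp hi))

theorem chainPath_cons_of_lt (T : ι → S → S) (a : S) {t : ℝ≥0} {e : ℝ≥0 × ι} (ω : ℕ → ℝ≥0 × ι)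
    (h : t < e.1) : chainPath T a t (consSeq (e, ω)) = a := by
  rw [chainPath, jumpCount_cons_of_lt ω h, embedded]

theorem NonExplosive.chainPath_cons (T : ι → S → S) (a : S) {t : ℝ≥0} {e : ℝ≥0 × ι}
    {ω : ℕ → ℝ≥0 × ι} (hω : NonExplosive ω) (h : e.1 ≤ t) :
    chainPath T a t (consSeq (e, ω)) = chainPath T (T e.2 a) (t - e.1) ω := by
  rw [chainPath, hω.jumpCount_cons h, embedded]
  rfl

/-- If the first transition comes after `s`, the path seen from time `s` is driven by the same
sequence with `s` subtracted from the first waiting time. -/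
theorem NonExplosive.chainPath_add_cons_of_lt (T : ι → S → S) (a : S) {s : ℝ≥0} (t : ℝ≥0)
    {e : ℝ≥0 × ι} {ω : ℕ → ℝ≥0 × ι} (hω : NonExplosive ω) (h : s < e.1) :
    chainPath T a (s + t) (consSeq (e, ω)) = chainPath T a t (consSeq ((e.1 - s, e.2), ω)) := by
  by_cases ht : s + t < e.1
  · rw [chainPath_cons_of_lt T a ω ht, chainPath_cons_of_lt T a ω]
    exact lt_tsub_iff_left.mpr ht
  · rw [not_lt] at ht
    have h' : e.1 - s ≤ t := tsub_le_iff_left.mpr ht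
    rw [hω.chainPath_cons T a ht, hω.chainPath_cons T a (e := (e.1 - s, e.2)) h']
    congr 1
    rw [tsub_tsub_eq_add_tsub_of_le h.le, add_comm]

/-- The path stays constant until the next arrival, which is strictly later than `t`. -/
theorem NonExplosive.exists_chainPath_eq (T : ι → S → S) (a : S) {ω : ℕ → ℝ≥0 × ι}
    (hω : NonExplosive ω) (t : ℝ≥0) :
    ∃ ε : ℝ≥0, 0 < ε ∧ ∀ u, t ≤ u → u < t + ε → chainPath T a u ω = chainPath T a t ω := by
  have h := hω.lt_arrival t
  refine ⟨arrival (jumpCount t ω + 1) ω - t, tsub_pos_of_lt h, fun u h1 h2 => ?_⟩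
  rw [add_tsub_cancel_of_le h.le] at h2
  have : jumpCount u ω = jumpCount t ω :=
    jumpCount_eq h2 fun i hi => (arrival_le_of_lt_jumpCount hi).trans h1
  rw [chainPath, chainPath, this]

section Measurability

variable [MeasurableSpace ι]

theorem measurable_shift : Measurable fun (ω : ℕ → ℝ≥0 × ι) (i : ℕ) => ω (i + 1) :=
  measurable_pi_lambda _ fun i => measurable_pi_apply (i + 1)

theorem measurable_arrival (k : ℕ) : Measurable (arrival (ι := ι) k) := by
  induction k with
  | zero => exact measurable_const
  | succ k ih =>
    exact (measurable_fst.comp (measurable_pi_apply 0)).add (ih.comp measurable_shift)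

theorem measurable_jumpCount (t : ℝ≥0) : Measurable (jumpCount (ι := ι) t) := by
  have hA : ∀ k, MeasurableSet {ω : ℕ → ℝ≥0 × ι | t < arrival (k + 1) ω} := fun k =>
    measurable_arrival (k + 1) measurableSet_Ioi
  refine measurable_to_countable' fun k => ?_
  -- The second set collects the sequences with no later arrival, for which `sInf ∅ = 0`.
  have hk : jumpCount (ι := ι) t ⁻¹' {k} =
      ({ω | t < arrival (k + 1) ω} ∩ ⋂ i ∈ Finset.range k, {ω | t < arrival (i + 1) ω}ᶜ) ∪
        {ω | k = 0 ∧ ω ∈ ⋂ i, {ω : ℕ → ℝ≥0 × ι | t < arrival (i + 1) ω}ᶜ} := by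
    ext ω
    simp only [Set.mem_preimage, Set.mem_singleton_iff, Set.mem_union, Set.mem_inter_iff,
      Set.mem_ofPred_eq, Set.mem_iInter, Set.mem_compl_iff, not_lt, Finset.mem_range]
    constructor
    · rintro rfl
      by_cases h : ∃ i, t < arrival (i + 1) ω
      · exact Or.inl ⟨Nat.sInf_mem h, fun i hi => arrival_le_of_lt_jumpCount hi⟩
      · push Not at h
        refine Or.inr ⟨?_, h⟩
        refine Nat.sInf_eq_zero.mpr (Or.inr ?_)
        ext i
        simpa using h i
    · rintro (⟨h1, h2⟩ | ⟨rfl, h⟩)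
      · exact jumpCount_eq h1 h2
      · refine Nat.sInf_eq_zero.mpr (Or.inr ?_)
        ext i
        simpa using h i
  rw [hk]
  refine ((hA k).inter (Finset.measurableSet_biInter _ fun i _ => (hA i).compl)).union ?_
  by_cases h0 : k = 0
  · simp only [h0, true_and]
    exact MeasurableSet.iInter fun i => (hA i).compl
  · simp [h0]

variable [MeasurableSpace S] [Countable S] [MeasurableSingletonClass S]
  [Countable ι] [MeasurableSingletonClass ι]

theorem measurable_embedded (T : ι → S → S) (k : ℕ) :
    Measurable fun p : S × (ℕ → ℝ≥0 × ι) => embedded T k p.1 p.2 := by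
  induction k with
  | zero => exact measurable_fst
  | succ k ih =>
    have hT : Measurable fun q : ι × S => T q.1 q.2 := Measurable.of_discrete
    exact ih.comp ((hT.comp ((measurable_snd.comp ((measurable_pi_apply 0).comp
      measurable_snd)).prodMk measurable_fst)).prodMk (measurable_shift.comp measurable_snd))

theorem measurable_chainPath_uncurry (T : ι → S → S) (t : ℝ≥0) :
    Measurable fun p : S × (ℕ → ℝ≥0 × ι) => chainPath T p.1 t p.2 := by
  have h : Measurable fun q : ℕ × (S × (ℕ → ℝ≥0 × ι)) => embedded T q.1 q.2.1 q.2.2 :=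
    measurable_from_prod_countable_right fun k => measurable_embedded T k
  exact h.comp (((measurable_jumpCount t).comp measurable_snd).prodMk measurable_id)

theorem measurable_chainPath (T : ι → S → S) (a : S) (t : ℝ≥0) : Measurable (chainPath T a t) :=
  (measurable_chainPath_uncurry T t).comp measurable_prodMk_left

end Measurability

/-- The law of the kind of a transition. -/
def markLaw [Fintype ι] [MeasurableSpace ι] (r : ι → ℝ) : Measure ι :=
  ∑ j, ENNReal.ofReal (r j / totalRate r) • Measure.dirac j

/-- The joint law of the waiting time for a transition and of its kind. -/
def stepLaw [Fintype ι] [MeasurableSpace ι] (r : ι → ℝ) : Measure (ℝ≥0 × ι) :=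
  (expLaw (totalRate r)).prod (markLaw r)

/-- The law of the sequence of waiting times and kinds of transitions. -/
def seqLaw [Fintype ι] [MeasurableSpace ι] (r : ι → ℝ) : Measure (ℕ → ℝ≥0 × ι) :=
  Measure.infinitePi fun _ => stepLaw r

section Laws

variable [Fintype ι] [MeasurableSpace ι] {r : ι → ℝ}

theorem isProbabilityMeasure_markLaw (hr : ∀ j, 0 ≤ r j) (hΛ : 0 < totalRate r) :
    IsProbabilityMeasure (markLaw r) := by
  refine ⟨?_⟩
  simp only [markLaw, Measure.finsetSum_apply, Measure.smul_apply, measure_univ, smul_eq_mul,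
    mul_one]
  rw [← ENNReal.ofReal_sum_of_nonneg fun j _ => div_nonneg (hr j) hΛ.le, ← Finset.sum_div,
    ← totalRate, div_self hΛ.ne', ENNReal.ofReal_one]

theorem isProbabilityMeasure_stepLaw (hr : ∀ j, 0 ≤ r j) (hΛ : 0 < totalRate r) :
    IsProbabilityMeasure (stepLaw r) := by
  have := isProbabilityMeasure_markLaw hr hΛ
  have := isProbabilityMeasure_expLaw hΛ
  unfold stepLaw
  infer_instance

theorem isProbabilityMeasure_seqLaw (hr : ∀ j, 0 ≤ r j) (hΛ : 0 < totalRate r) :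
    IsProbabilityMeasure (seqLaw r) := by
  have := isProbabilityMeasure_stepLaw hr hΛ
  unfold seqLaw
  infer_instance

variable [MeasurableSingletonClass ι]

theorem lintegral_markLaw (f : ι → ℝ≥0∞) :
    ∫⁻ j, f j ∂markLaw r = ∑ j, ENNReal.ofReal (r j / totalRate r) * f j := by
  simp [markLaw, lintegral_finsetSum_measure]

theorem lintegral_stepLaw (hr : ∀ j, 0 ≤ r j) (hΛ : 0 < totalRate r) {f : ℝ≥0 × ι → ℝ≥0∞}
    (hf : Measurable f) :
    ∫⁻ e, f e ∂stepLaw r =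
      ∑ j, ENNReal.ofReal (r j / totalRate r) * ∫⁻ ξ, f (ξ, j) ∂expLaw (totalRate r) := by
  have := isProbabilityMeasure_markLaw hr hΛ
  have := isProbabilityMeasure_expLaw hΛ
  rw [stepLaw, lintegral_prod_symm _ hf.aemeasurable, lintegral_markLaw]

theorem lintegral_stepLaw_memoryless (hr : ∀ j, 0 ≤ r j) (hΛ : 0 < totalRate r) (s : ℝ≥0)
    {f : ℝ≥0 × ι → ℝ≥0∞} (hf : Measurable f) :
    ∫⁻ e, (if s < e.1 then f (e.1 - s, e.2) else 0) ∂stepLaw r =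
      ENNReal.ofReal (Real.exp (-(totalRate r * s))) * ∫⁻ e, f e ∂stepLaw r := by
  have hm : Measurable fun e : ℝ≥0 × ι => if s < e.1 then f (e.1 - s, e.2) else 0 :=
    Measurable.ite (measurable_fst measurableSet_Ioi)
      (hf.comp ((measurable_fst.sub_const s).prodMk measurable_snd)) measurable_const
  rw [lintegral_stepLaw hr hΛ hm, lintegral_stepLaw hr hΛ hf, Finset.mul_sum]
  refine Finset.sum_congr rfl fun j _ => ?_
  rw [lintegral_expLaw_memoryless _ s (f := fun ξ => f (ξ, j))
    (hf.comp measurable_prodMk_right)]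
  ring

theorem lintegral_exp_neg_stepLaw_lt_one (hr : ∀ j, 0 ≤ r j) (hΛ : 0 < totalRate r) :
    ∫⁻ e, ENNReal.ofReal (Real.exp (-(e.1 : ℝ))) ∂stepLaw r < 1 := by
  rw [lintegral_stepLaw hr hΛ (by fun_prop)]
  simp only
  rw [← Finset.sum_mul,
    ← ENNReal.ofReal_sum_of_nonneg fun j _ => div_nonneg (hr j) hΛ.le, ← Finset.sum_div,
    ← totalRate, div_self hΛ.ne', ENNReal.ofReal_one, one_mul]
  exact lintegral_exp_neg_expLaw_lt_one hΛ

/-- Bounded solutions of the renewal equation are unique. -/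
theorem le_of_renewal (hr : ∀ j, 0 ≤ r j) (hΛ : 0 < totalRate r) (T : ι → S → S)
    {u v ε : ℝ≥0 → S → ℝ≥0∞} (hu1 : ∀ s a, u s a ≤ 1)
    (hu : ∀ s a, u s a =
      ∫⁻ e, (if e.1 ≤ s then u (s - e.1) (T e.2 a) else 0) ∂stepLaw r + ε s a)
    (hv : ∀ s a, v s a =
      ∫⁻ e, (if e.1 ≤ s then v (s - e.1) (T e.2 a) else 0) ∂stepLaw r + ε s a)
    (s : ℝ≥0) (a : S) : u s a ≤ v s a := by
  set q := ∫⁻ e, ENNReal.ofReal (Real.exp (-(e.1 : ℝ))) ∂stepLaw r with hq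
  have hq1 : q < 1 := lintegral_exp_neg_stepLaw_lt_one hr hΛ
  -- The weight `exp s` makes one renewal step a contraction: `exp (s - ξ) = exp s * exp (-ξ)`, and
  -- integrating over `ξ` yields the factor `q < 1`.
  have hk : ∀ (k : ℕ) (s : ℝ≥0) (a : S),
      u s a ≤ v s a + q ^ k * ENNReal.ofReal (Real.exp s) := by
    intro k
    induction k with
    | zero =>
      intro s a
      refine (hu1 s a).trans (le_add_left ?_)
      rw [pow_zero, one_mul, ENNReal.one_le_ofReal]
      exact Real.one_le_exp s.coe_nonneg
    | succ k ih =>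
      intro s a
      rw [hu, hv]
      have h1 : ∫⁻ e, (if e.1 ≤ s then u (s - e.1) (T e.2 a) else 0) ∂stepLaw r ≤
          ∫⁻ e, ((if e.1 ≤ s then v (s - e.1) (T e.2 a) else 0) +
            q ^ k * ENNReal.ofReal (Real.exp s) * ENNReal.ofReal (Real.exp (-(e.1 : ℝ))))
            ∂stepLaw r := by
        refine lintegral_mono fun e => ?_
        by_cases he : e.1 ≤ s
        · simp only [he, if_true]
          refine (ih _ _).trans_eq ?_
          rw [mul_assoc, ← ENNReal.ofReal_mul (Real.exp_nonneg _), ← Real.exp_add,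
            NNReal.coe_sub he, sub_eq_add_neg]
        · simp only [he, if_false]
          exact zero_le
      rw [lintegral_add_right _ (by fun_prop), lintegral_const_mul _ (by fun_prop), ← hq] at h1
      calc _ ≤ _ := add_le_add_left h1 _
        _ = _ := by ring
  have hlim : Filter.Tendsto (fun k : ℕ => v s a + q ^ k * ENNReal.ofReal (Real.exp s))
      Filter.atTop (nhds (v s a + 0 * ENNReal.ofReal (Real.exp s))) :=
    tendsto_const_nhds.add (ENNReal.Tendsto.mul_const
      (ENNReal.tendsto_pow_atTop_nhds_zero_of_lt_one hq1) (Or.inr ENNReal.ofReal_ne_top))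
  rw [zero_mul, add_zero] at hlim
  exact ge_of_tendsto' hlim fun k => hk k s a

/-- Decomposition at the first transition: term `k` of the series after it becomes term `k + 1`, and
the added summand is the term without transitions. -/
theorem heat_renewal (hr : ∀ j, 0 ≤ r j) (hΛ : 0 < totalRate r) (T : ι → S → S)
    (f : S → ℝ≥0∞) (s : ℝ≥0) (a : S) :
    heat r T s f a = ∫⁻ e, (if e.1 ≤ s then heat r T (s - e.1) f (T e.2 a) else 0) ∂stepLaw r +
      ENNReal.ofReal (Real.exp (-(totalRate r * s))) * f a := by
  have hjw : ∀ k, Measurable fun t : ℝ≥0 => jumpWeight r t k := fun k => by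
    unfold jumpWeight
    fun_prop
  have hmk : ∀ k, Measurable fun ξ : ℝ≥0 => if ξ ≤ s then jumpWeight r (s - ξ) k else 0 := fun k =>
    Measurable.ite measurableSet_Iic ((hjw k).comp (measurable_id.const_sub s)) measurable_const
  have hmk' : ∀ k, Measurable fun e : ℝ≥0 × ι => (if e.1 ≤ s then jumpWeight r (s - e.1) k else 0) *
      (jumpOp r T)^[k] f (T e.2 a) := fun k =>
    ((hmk k).comp measurable_fst).mul
      ((Measurable.of_discrete (f := fun j => (jumpOp r T)^[k] f (T j a))).comp measurable_snd)
  have hint : ∫⁻ e, (if e.1 ≤ s then heat r T (s - e.1) f (T e.2 a) else 0) ∂stepLaw r =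
      ∑' k, jumpWeight r s (k + 1) * (jumpOp r T)^[k + 1] f a := by
    calc _ = ∫⁻ e, ∑' k, (if e.1 ≤ s then jumpWeight r (s - e.1) k else 0) *
          (jumpOp r T)^[k] f (T e.2 a) ∂stepLaw r := by
          refine lintegral_congr fun e => ?_
          by_cases he : e.1 ≤ s <;> simp [he, heat]
      _ = _ := by
          rw [lintegral_tsum fun k => (hmk' k).aemeasurable]
          refine tsum_congr fun k => ?_
          rw [lintegral_stepLaw hr hΛ (hmk' k), Function.iterate_succ_apply', jumpOp,
            Finset.mul_sum]
          refine Finset.sum_congr rfl fun j _ => ?_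
          simp only
          rw [lintegral_mul_const _ (hmk k), lintegral_jumpWeight_sub hΛ.le, ← mul_assoc,
            ← mul_assoc, ← mul_assoc, ← ENNReal.ofReal_mul (div_nonneg (hr j) hΛ.le),
            div_mul_cancel₀ _ hΛ.ne']
          ring
  rw [hint, heat, tsum_eq_zero_add' ENNReal.summable, add_comm]
  simp [jumpWeight]

end Laws

end Construction

/-! ### Existence of the chain for every initial law. -/

section Existence

open MeasureTheory

variable {S ι : Type*} [Fintype ι] [MeasurableSpace ι] [MeasurableSingletonClass ι] {r : ι → ℝ}

/-- The probability that all arrivals are at most `s` solves the homogeneous renewal equation, so it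
vanishes by uniqueness. A one-point state space suffices, since states play no role. -/
theorem ae_nonExplosive (hr : ∀ j, 0 ≤ r j) (hΛ : 0 < totalRate r) :
    ∀ᵐ ω ∂seqLaw r, NonExplosive ω := by
  have := isProbabilityMeasure_stepLaw hr hΛ
  have := isProbabilityMeasure_seqLaw hr hΛ
  have hm : ∀ s, MeasurableSet {ω : ℕ → ℝ≥0 × ι | ∀ k, arrival k ω ≤ s} := by
    intro s
    rw [Set.ofPred_forall]
    exact MeasurableSet.iInter fun k => measurable_arrival k measurableSet_Iic
  have h0 : ∀ s : ℝ≥0, seqLaw r {ω | ∀ k, arrival k ω ≤ s} = 0 := by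
    intro s
    have h := le_of_renewal hr hΛ (T := fun _ (a : Unit) => a)
      (u := fun s _ => seqLaw r {ω | ∀ k, arrival k ω ≤ s}) (v := fun _ _ => 0)
      (ε := fun _ _ => 0) (fun _ _ => prob_le_one) ?_ (fun _ _ => by simp) s ()
    · exact le_antisymm h zero_le
    · intro s _
      rw [add_zero, seqLaw, infinitePi_apply_eq_lintegral _ (hm s)]
      refine lintegral_congr fun e => ?_
      by_cases he : e.1 ≤ s
      · rw [if_pos he]
        congr 1
        ext ω
        constructor
        · intro h k
          exact (le_tsub_iff_left he).mpr (h (k + 1))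
        · rintro h (_ | k)
          · exact zero_le
          · exact (le_tsub_iff_left he).mp (h k)
      · rw [if_neg he]
        convert measure_empty (μ := Measure.infinitePi fun _ : ℕ => stepLaw r)
        refine Set.eq_empty_of_forall_notMem fun ω h => he ?_
        simpa [arrival, consSeq] using h 1
  have hall : ∀ᵐ ω ∂seqLaw r, ∀ n : ℕ, ¬ ∀ k, arrival k ω ≤ (n : ℝ≥0) :=
    ae_all_iff.mpr fun n => by
      rw [ae_iff]
      simpa using h0 n
  filter_upwards [hall] with ω hω t
  obtain ⟨n, hn⟩ := exists_nat_ge t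
  have := hω n
  push Not at this
  obtain ⟨k, hk⟩ := this
  exact ⟨k, hn.trans_lt hk⟩

variable [MeasurableSpace S] [Countable S] [MeasurableSingletonClass S]

theorem measurableSet_chainPath (T : ι → S → S) (a c : S) (s : ℝ≥0) {B : Set (ℝ≥0 → S)}
    (hB : MeasurableSet B) :
    MeasurableSet {ω | chainPath T a s ω = c ∧ (fun t => chainPath T a (s + t) ω) ∈ B} :=
  (measurable_chainPath T a s (measurableSet_singleton c)).inter
    (measurable_pi_lambda _ (fun t => measurable_chainPath T a (s + t)) hB)

/-- If the first transition occurs by time `s`, the path restarts from the new state. Otherwise it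
is still at `a`, and the residual waiting time is again exponential, so its future is that of a
fresh path. -/
theorem chainPath_renewal (hr : ∀ j, 0 ≤ r j) (hΛ : 0 < totalRate r) (T : ι → S → S) (c : S)
    {B : Set (ℝ≥0 → S)} (hB : MeasurableSet B) (s : ℝ≥0) (a : S) :
    seqLaw r {ω | chainPath T a s ω = c ∧ (fun t => chainPath T a (s + t) ω) ∈ B} =
      ∫⁻ e, (if e.1 ≤ s then seqLaw r {ω | chainPath T (T e.2 a) (s - e.1) ω = c ∧
        (fun t => chainPath T (T e.2 a) (s - e.1 + t) ω) ∈ B} else 0) ∂stepLaw r +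
      ENNReal.ofReal (Real.exp (-(totalRate r * s))) *
        (Set.indicator {c} 1 a * seqLaw r {ω | (fun t => chainPath T c t ω) ∈ B}) := by
  have := isProbabilityMeasure_stepLaw hr hΛ
  have := isProbabilityMeasure_seqLaw hr hΛ
  have hB' : ∀ b : S, MeasurableSet {ω : ℕ → ℝ≥0 × ι | (fun t => chainPath T b t ω) ∈ B} :=
    fun b => measurable_pi_lambda _ (fun t => measurable_chainPath T b t) hB
  set h : ℝ≥0 × ι → ℝ≥0∞ := fun e => Set.indicator {c} 1 a *
    seqLaw r {ω | (fun t => chainPath T c t (consSeq (e, ω))) ∈ B} with hh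
  have hhm : Measurable h :=
    (measurable_measure_prodMk_left (measurable_consSeq (hB' c))).const_mul _
  have hhint : ∫⁻ e, h e ∂stepLaw r =
      Set.indicator {c} 1 a * seqLaw r {ω | (fun t => chainPath T c t ω) ∈ B} := by
    rw [seqLaw, infinitePi_apply_eq_lintegral _ (hB' c), ← lintegral_const_mul]
    · rfl
    · exact measurable_measure_prodMk_left (measurable_consSeq (hB' c))
  have hm : Measurable fun e : ℝ≥0 × ι => if s < e.1 then h (e.1 - s, e.2) else 0 :=
    Measurable.ite (measurable_fst measurableSet_Ioi)
      (hhm.comp ((measurable_fst.sub_const s).prodMk measurable_snd)) measurable_const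
  -- Undoing lack of memory writes both sides as integrals over the first step, which are then
  -- compared pointwise.
  rw [← hhint, ← lintegral_stepLaw_memoryless hr hΛ s hhm, ← lintegral_add_right _ hm]
  conv_lhs => rw [seqLaw, infinitePi_apply_eq_lintegral _ (measurableSet_chainPath T a c s hB)]
  refine lintegral_congr fun e => ?_
  by_cases he : e.1 ≤ s
  · rw [if_pos he, if_neg (not_lt.mpr he), add_zero]
    refine measure_congr ?_
    filter_upwards [ae_nonExplosive hr hΛ] with ω hω
    refine propext (and_congr ?_ ?_)
    · rw [hω.chainPath_cons T a he]
    · have : (fun t => chainPath T a (s + t) (consSeq (e, ω))) =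
          fun t => chainPath T (T e.2 a) (s - e.1 + t) ω := by
        ext t
        rw [hω.chainPath_cons T a (he.trans le_self_add), tsub_add_eq_add_tsub he]
      rw [this]
  · rw [not_le] at he
    rw [if_neg (not_le.mpr he), if_pos he, zero_add, hh]
    by_cases hac : a = c
    · subst hac
      simp only [Set.indicator_of_mem (Set.mem_singleton a), Pi.one_apply, one_mul]
      refine measure_congr ?_
      filter_upwards [ae_nonExplosive hr hΛ] with ω hω
      refine propext ((and_iff_right ?_).trans ?_)
      · exact chainPath_cons_of_lt T a ω he
      · simp only [hω.chainPath_add_cons_of_lt T a _ he]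
        rfl
    · simp only [Set.indicator_of_notMem (s := {c}) (by simpa using hac), zero_mul]
      convert measure_empty (μ := Measure.infinitePi fun _ : ℕ => stepLaw r)
      refine Set.eq_empty_of_forall_notMem fun ω hω => hac ?_
      rw [← hω.1, chainPath_cons_of_lt T a ω he]

/-- Both sides are bounded by one and solve the same renewal equation. -/
theorem seqLaw_chainPath_eq (hr : ∀ j, 0 ≤ r j) (hΛ : 0 < totalRate r) (T : ι → S → S) (c : S)
    (s : ℝ≥0) (a : S) :
    seqLaw r {ω | chainPath T a s ω = c} = heat r T s (Set.indicator {c} 1) a := by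
  have := isProbabilityMeasure_seqLaw hr hΛ
  have h1 : ∀ s a, seqLaw r {ω | chainPath T a s ω = c} =
      ∫⁻ e, (if e.1 ≤ s then seqLaw r {ω | chainPath T (T e.2 a) (s - e.1) ω = c} else 0)
        ∂stepLaw r + ENNReal.ofReal (Real.exp (-(totalRate r * s))) * Set.indicator {c} 1 a := by
    intro s a
    simpa using chainPath_renewal hr hΛ T c MeasurableSet.univ s a
  have h2 := heat_renewal hr hΛ T (Set.indicator {c} 1)
  refine le_antisymm (le_of_renewal hr hΛ T (fun _ _ => prob_le_one) h1 h2 s a)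
    (le_of_renewal hr hΛ T (u := fun s a => heat r T s (Set.indicator {c} 1) a) ?_ h2 h1 s a)
  intro s a
  have h3 := heat_eq_tsum r T s 1 a
  simp only [heat_one hr, Pi.one_apply, one_mul] at h3
  rw [h3]
  exact ENNReal.le_tsum c

/-- Markov property for the whole future path, again by uniqueness for the renewal equation. -/
theorem seqLaw_chainPath_shift (hr : ∀ j, 0 ≤ r j) (hΛ : 0 < totalRate r) (T : ι → S → S) (c : S)
    {B : Set (ℝ≥0 → S)} (hB : MeasurableSet B) (s : ℝ≥0) (a : S) :
    seqLaw r {ω | chainPath T a s ω = c ∧ (fun t => chainPath T a (s + t) ω) ∈ B} =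
      heat r T s (Set.indicator {c} 1) a * seqLaw r {ω | (fun t => chainPath T c t ω) ∈ B} := by
  have := isProbabilityMeasure_seqLaw hr hΛ
  set C := seqLaw r {ω | (fun t => chainPath T c t ω) ∈ B} with hC
  have hC1 : C ≤ 1 := prob_le_one
  have h1 := chainPath_renewal hr hΛ T c hB
  have h2 : ∀ s a, heat r T s (Set.indicator {c} 1) a * C =
      ∫⁻ e, (if e.1 ≤ s then heat r T (s - e.1) (Set.indicator {c} 1) (T e.2 a) * C else 0)
        ∂stepLaw r + ENNReal.ofReal (Real.exp (-(totalRate r * s))) *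
          (Set.indicator {c} 1 a * C) := by
    intro s a
    rw [heat_renewal hr hΛ, add_mul, mul_assoc,
      ← lintegral_mul_const' _ _ (ne_top_of_le_ne_top ENNReal.one_ne_top hC1)]
    simp only [ite_mul, zero_mul]
  refine le_antisymm (le_of_renewal hr hΛ T (fun _ _ => prob_le_one) h1 h2 s a)
    (le_of_renewal hr hΛ T (u := fun s a => heat r T s (Set.indicator {c} 1) a * C) ?_ h2 h1 s a)
  intro s a
  rw [← seqLaw_chainPath_eq hr hΛ]
  exact mul_le_one' prob_le_one hC1

/-- The Markov property of the constructed chain, for cylinders. -/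
theorem seqLaw_chainPath_cylinder (hr : ∀ j, 0 ≤ r j) (hΛ : 0 < totalRate r) (T : ι → S → S)
    (t : ℝ≥0) (a b : S) (n : ℕ) : ∀ (I : Finset ℝ≥0) (_ : I.card = n) (c : ℝ≥0 → S) (s : ℝ≥0)
    (_ : ∀ u ∈ I, u ≤ s) (x : S),
    seqLaw r {ω | (∀ u ∈ I, chainPath T x u ω = c u) ∧ chainPath T x s ω = a ∧
        chainPath T x (s + t) ω = b} =
      seqLaw r {ω | (∀ u ∈ I, chainPath T x u ω = c u) ∧ chainPath T x s ω = a} *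
        heat r T t (Set.indicator {b} 1) a := by
  classical
  induction n with
  | zero =>
    intro I hI c s _ x
    rw [Finset.card_eq_zero] at hI
    subst hI
    have h := seqLaw_chainPath_shift hr hΛ T a
      (measurableSet_eval_eq t b) s x
    simp only [Set.mem_ofPred_eq, seqLaw_chainPath_eq hr hΛ] at h
    simpa [seqLaw_chainPath_eq hr hΛ] using h
  | succ n ih =>
    intro I hI c s hIs x
    have hne : I.Nonempty := Finset.card_pos.mp (by omega)
    -- Restart at the earliest time `m`: the remaining times, shifted by `m`, form a set with one
    -- element fewer.
    set m := I.min' hne with hm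
    have hmI : m ∈ I := Finset.min'_mem I hne
    have hmle : ∀ u ∈ I, m ≤ u := fun u hu => Finset.min'_le I u hu
    have hms : m ≤ s := hIs m hmI
    set I' := I.erase m with hI'
    have hI'I : ∀ u ∈ I', u ∈ I := fun u hu => Finset.mem_of_mem_erase hu
    set J := I'.image (fun u => u - m) with hJ
    have hinj : Set.InjOn (fun u => u - m) (I' : Set ℝ≥0) := by
      intro u hu v hv huv
      exact (tsub_left_inj (hmle u (hI'I u hu)) (hmle v (hI'I v hv))).mp huv
    have hJcard : J.card = n := by
      rw [hJ, Finset.card_image_of_injOn hinj, hI', Finset.card_erase_of_mem hmI, hI]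
      rfl
    have hJs : ∀ u ∈ J, u ≤ s - m := by
      intro u hu
      obtain ⟨v, hv, rfl⟩ := Finset.mem_image.mp hu
      exact tsub_le_tsub_right (hIs v (hI'I v hv)) m
    have hB1 : MeasurableSet {f : ℝ≥0 → S | (∀ u ∈ J, f u = c (u + m)) ∧ f (s - m) = a ∧
        f (s - m + t) = b} :=
      (measurableSet_pi_cylinder J fun u => c (u + m)).inter
        ((measurableSet_eval_eq (s - m) a).inter (measurableSet_eval_eq (s - m + t) b))
    have hB2 : MeasurableSet {f : ℝ≥0 → S | (∀ u ∈ J, f u = c (u + m)) ∧ f (s - m) = a} :=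
      (measurableSet_pi_cylinder J fun u => c (u + m)).inter
        (measurableSet_eval_eq (s - m) a)
    have hcyl : ∀ ω, (∀ u ∈ I, chainPath T x u ω = c u) ↔ chainPath T x m ω = c m ∧
        ∀ u ∈ J, chainPath T x (m + u) ω = c (u + m) := by
      intro ω
      constructor
      · intro h
        refine ⟨h m hmI, fun u hu => ?_⟩
        obtain ⟨v, hv, rfl⟩ := Finset.mem_image.mp hu
        have hv' := hI'I v hv
        rw [add_tsub_cancel_of_le (hmle v hv'), tsub_add_cancel_of_le (hmle v hv')]
        exact h v hv'
      · rintro ⟨h1, h2⟩ u hu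
        by_cases hum : u = m
        · rwa [hum]
        · have h3 := h2 (u - m)
            (Finset.mem_image_of_mem _ (Finset.mem_erase.mpr ⟨hum, hu⟩))
          rwa [add_tsub_cancel_of_le (hmle u hu), tsub_add_cancel_of_le (hmle u hu)] at h3
    have h1 := seqLaw_chainPath_shift hr hΛ T (c m) hB1 m x
    have h2 := seqLaw_chainPath_shift hr hΛ T (c m) hB2 m x
    simp only [Set.mem_ofPred_eq, ← add_assoc, add_tsub_cancel_of_le hms] at h1 h2
    simp only [hcyl, and_assoc]
    rw [h1, h2, ih J hJcard (fun u => c (u + m)) (s - m) hJs (c m), mul_assoc]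

theorem prod_chainPath_cylinder (hr : ∀ j, 0 ≤ r j) (hΛ : 0 < totalRate r) (T : ι → S → S)
    (ν : Measure S) [IsProbabilityMeasure ν] (t : ℝ≥0) (a b : S) (I : Finset ℝ≥0) (c : ℝ≥0 → S)
    (s : ℝ≥0) (hI : ∀ u ∈ I, u ≤ s) :
    (ν.prod (seqLaw r)) {p | (∀ u ∈ I, chainPath T p.1 u p.2 = c u) ∧ chainPath T p.1 s p.2 = a ∧
        chainPath T p.1 (s + t) p.2 = b} =
      (ν.prod (seqLaw r)) {p | (∀ u ∈ I, chainPath T p.1 u p.2 = c u) ∧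
        chainPath T p.1 s p.2 = a} * heat r T t (Set.indicator {b} 1) a := by
  have := isProbabilityMeasure_seqLaw hr hΛ
  have hpath : Measurable fun (p : S × (ℕ → ℝ≥0 × ι)) (u : ℝ≥0) => chainPath T p.1 u p.2 :=
    measurable_pi_lambda _ fun u => measurable_chainPath_uncurry T u
  have h1 : MeasurableSet {p : S × (ℕ → ℝ≥0 × ι) | (∀ u ∈ I, chainPath T p.1 u p.2 = c u) ∧
      chainPath T p.1 s p.2 = a ∧ chainPath T p.1 (s + t) p.2 = b} :=
    (hpath (measurableSet_pi_cylinder I c)).inter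
      ((measurable_chainPath_uncurry T s (measurableSet_singleton a)).inter
        (measurable_chainPath_uncurry T (s + t) (measurableSet_singleton b)))
  have h2 : MeasurableSet {p : S × (ℕ → ℝ≥0 × ι) | (∀ u ∈ I, chainPath T p.1 u p.2 = c u) ∧
      chainPath T p.1 s p.2 = a} :=
    (hpath (measurableSet_pi_cylinder I c)).inter
      (measurable_chainPath_uncurry T s (measurableSet_singleton a))
  rw [Measure.prod_apply h1, Measure.prod_apply h2,
    ← lintegral_mul_const _ (measurable_measure_prodMk_left h2)]
  exact lintegral_congr fun x => seqLaw_chainPath_cylinder hr hΛ T t a b _ I rfl c s hI x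

/-- The chain with initial law `ν`. -/
theorem isMarkovChain_chainPath (hr : ∀ j, 0 ≤ r j) (hΛ : 0 < totalRate r) (T : ι → S → S)
    (ν : Measure S) [IsProbabilityMeasure ν] :
    IsMarkovChain r T (ν.prod (seqLaw r))
      (fun t (p : S × (ℕ → ℝ≥0 × ι)) => chainPath T p.1 t p.2) := by
  have := isProbabilityMeasure_seqLaw hr hΛ
  set X := fun t (p : S × (ℕ → ℝ≥0 × ι)) => chainPath T p.1 t p.2 with hX
  set μ := ν.prod (seqLaw r) with hμ
  have hXm : ∀ t, Measurable (X t) := fun t => measurable_chainPath_uncurry T t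
  refine ⟨inferInstance, hXm, ?_, ?_⟩
  · have h : ∀ᵐ p ∂μ, NonExplosive p.2 :=
      Measure.quasiMeasurePreserving_snd.ae (ae_nonExplosive hr hΛ)
    filter_upwards [h] with p hp t
    exact hp.exists_chainPath_eq T p.1 t
  intro s t E hE a b
  set K := heat r T t (Set.indicator {b} 1) a with hK
  have hK1 : K ≤ 1 := by
    rw [hK, ← seqLaw_chainPath_eq hr hΛ]
    exact prob_le_one
  -- Past events are preimages under the path restricted to `[0, s]`. The Markov property becomes an
  -- equality of two finite measures on that path space, tested on cylinders.
  set path : S × (ℕ → ℝ≥0 × ι) → Set.Iic s → S := fun p u => X u p with hpathdef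
  have hpath : Measurable path := measurable_pi_lambda _ fun u => hXm u
  have hpast : pastEvents X s ≤ MeasurableSpace.comap path inferInstance := by
    refine iSup₂_le fun u hu => ?_
    rintro _ ⟨B, hB, rfl⟩
    exact ⟨(fun f => f ⟨u, hu⟩) ⁻¹' B, measurable_pi_apply _ hB, rfl⟩
  obtain ⟨F, hF, rfl⟩ := hpast E hE
  have hKfin : K ≠ ∞ := ne_top_of_le_ne_top ENNReal.one_ne_top hK1
  have hA1 : MeasurableSet (X s ⁻¹' {a} ∩ X (s + t) ⁻¹' {b}) :=
    (hXm s (measurableSet_singleton a)).inter (hXm (s + t) (measurableSet_singleton b))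
  have hA2 : MeasurableSet (X s ⁻¹' {a}) := hXm s (measurableSet_singleton a)
  have hmeq : (μ.restrict (X s ⁻¹' {a} ∩ X (s + t) ⁻¹' {b})).map path =
      (K.toNNReal • μ.restrict (X s ⁻¹' {a})).map path := by
    refine ext_of_cylinders ∅ fun I _ c => ?_
    have hcyl := measurableSet_pi_cylinder I c
    rw [Measure.map_apply hpath hcyl, Measure.map_apply hpath hcyl, Measure.smul_apply,
      Measure.restrict_apply (hpath hcyl), Measure.restrict_apply (hpath hcyl)]
    have h := prod_chainPath_cylinder hr hΛ T ν t a b (I.map (Function.Embedding.subtype _))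
      (fun u => if hu : u ≤ s then c ⟨u, hu⟩ else a) s (by
        intro u hu
        obtain ⟨v, _, rfl⟩ := Finset.mem_map.mp hu
        exact v.2)
    have hiff : ∀ p : S × (ℕ → ℝ≥0 × ι), (∀ u ∈ I.map (Function.Embedding.subtype _),
        chainPath T p.1 u p.2 = if hu : u ≤ s then c ⟨u, hu⟩ else a) ↔ ∀ u ∈ I, path p u = c u := by
      intro p
      rw [Finset.forall_mem_map]
      refine forall₂_congr fun u _ => ?_
      have hu : (Function.Embedding.subtype (fun u => u ∈ Set.Iic s) u : ℝ≥0) ≤ s := u.2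
      rw [dif_pos hu]
      rfl
    simp only [hiff] at h
    rw [ENNReal.smul_def, ENNReal.coe_toNNReal hKfin, smul_eq_mul, mul_comm]
    exact h
  have h := congrArg (fun m => (m F).toReal) hmeq
  simp only [Measure.map_apply hpath hF, Measure.smul_apply,
    Measure.restrict_apply (hpath hF)] at h
  rw [ENNReal.smul_def, ENNReal.coe_toNNReal hKfin, smul_eq_mul, mul_comm,
    ENNReal.toReal_mul, hK, ← ofReal_transProb hr,
    ENNReal.toReal_ofReal (transProb_nonneg hr T t a b),
    ← Set.inter_assoc] at h
  exact h

theorem map_chainPath_zero (hr : ∀ j, 0 ≤ r j) (hΛ : 0 < totalRate r) (T : ι → S → S)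
    (ν : Measure S) [IsProbabilityMeasure ν] :
    (ν.prod (seqLaw r)).map (fun p => chainPath T p.1 0 p.2) = ν := by
  have := isProbabilityMeasure_seqLaw hr hΛ
  refine Measure.ext_of_singleton fun c => ?_
  have hm : MeasurableSet ((fun p : S × (ℕ → ℝ≥0 × ι) => chainPath T p.1 0 p.2) ⁻¹' {c}) :=
    measurable_chainPath_uncurry T 0 (measurableSet_singleton c)
  rw [Measure.map_apply (measurable_chainPath_uncurry T 0) (measurableSet_singleton c),
    Measure.prod_apply hm, ← lintegral_indicator_one (measurableSet_singleton c)]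
  refine lintegral_congr fun x => (seqLaw_chainPath_eq hr hΛ T c 0 x).trans ?_
  rw [heat, tsum_eq_single 0 fun k hk => by simp [jumpWeight, hk]]
  simp [jumpWeight]

theorem exists_isMarkovChain {S ι : Type} [Fintype ι] [MeasurableSpace ι]
    [MeasurableSingletonClass ι] [MeasurableSpace S] [Countable S] [MeasurableSingletonClass S]
    {r : ι → ℝ} (hr : ∀ j, 0 ≤ r j) (hΛ : 0 < totalRate r) (T : ι → S → S) (ν : Measure S)
    [IsProbabilityMeasure ν] :
    ∃ (Ω : Type) (_ : MeasurableSpace Ω) (μ : Measure Ω) (X : ℝ≥0 → Ω → S),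
      IsMarkovChain r T μ X ∧ μ.map (X 0) = ν :=
  ⟨_, _, _, _, isMarkovChain_chainPath hr hΛ T ν, map_chainPath_zero hr hΛ T ν⟩

end Existence

/-! ### Combinatorics of the array transitions: projection, preimages of a shift, reset words. -/

section Board

variable {n : ℕ}

theorem mem_triangle {k j : ℕ} : (k, j) ∈ triangle n ↔ 1 ≤ j ∧ j ≤ k ∧ k ≤ n := by
  simp only [triangle, Finset.mem_filter, Finset.mem_product, Finset.mem_Icc]
  omega

theorem entry_of_mem (A : TriArray n) {k j : ℕ} (h : (k, j) ∈ triangle n) :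
    entry A k j = A ⟨(k, j), h⟩ := dif_pos h

theorem entry_of_notMem (A : TriArray n) {k j : ℕ} (h : (k, j) ∉ triangle n) :
    entry A k j = 0 := dif_neg h

theorem triArray_ext {A B : TriArray n}
    (h : ∀ k j, 1 ≤ j → j ≤ k → k ≤ n → entry A k j = entry B k j) : A = B := by
  ext ⟨⟨k, j⟩, hp⟩
  obtain ⟨h1, h2, h3⟩ := mem_triangle.mp hp
  have := h k j h1 h2 h3
  rwa [entry_of_mem A hp, entry_of_mem B hp] at this

theorem entry_add (A B : TriArray n) (k j : ℕ) : entry (A + B) k j = entry A k j + entry B k j := by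
  by_cases h : (k, j) ∈ triangle n
  · simp [entry_of_mem _ h]
  · simp [entry_of_notMem _ h]

theorem entry_zero (k j : ℕ) : entry (0 : TriArray n) k j = 0 := by
  by_cases h : (k, j) ∈ triangle n
  · simp [entry_of_mem _ h]
  · simp [entry_of_notMem _ h]

theorem entry_nsmul (m : ℕ) (A : TriArray n) (k j : ℕ) : entry (m • A) k j = m * entry A k j := by
  by_cases h : (k, j) ∈ triangle n
  · simp [entry_of_mem _ h]
  · simp [entry_of_notMem _ h]

/-- The array whose only nonzero entry is a `1` at the `i`-th diagonal position. -/
def unitArray (n : ℕ) (i : Fin n) : TriArray n :=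
  fun p => if p.1 = ((i : ℕ) + 1, (i : ℕ) + 1) then 1 else 0

theorem entry_unitArray (i : Fin n) (k j : ℕ) :
    entry (unitArray n i) k j = if k = i + 1 ∧ j = i + 1 then 1 else 0 := by
  by_cases h : (k, j) ∈ triangle n
  · simp [entry_of_mem _ h, unitArray]
  · rw [entry_of_notMem _ h, if_neg]
    rintro ⟨rfl, rfl⟩
    exact h (mem_triangle.mpr ⟨by omega, le_rfl, i.2⟩)

theorem triStep_succ (i : Fin n) (A : TriArray n) : triStep n i.succ A = A + unitArray n i := by
  ext p
  by_cases hp : p.1 = ((i : ℕ) + 1, (i : ℕ) + 1) <;> simp [triStep, unitArray, hp]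

theorem entry_triStep_zero (A : TriArray n) {k j : ℕ} (h : (k, j) ∈ triangle n) :
    entry (triStep n 0 A) k j = entry A (k - 1) j := by
  simp [entry_of_mem _ h, triStep]

theorem rowSum_triStep_zero (A : TriArray n) {i : ℕ} (hi : i < n) :
    rowSum (triStep n 0 A) (i + 1) = rowSum A i := by
  rw [rowSum, rowSum, Finset.sum_Icc_succ_top (by omega),
    entry_triStep_zero A (mem_triangle.mpr ⟨by omega, le_rfl, hi⟩),
    entry_of_notMem A (fun h => by have := mem_triangle.mp h; omega), add_zero]
  refine Finset.sum_congr rfl fun j hj => ?_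
  rw [Finset.mem_Icc] at hj
  rw [entry_triStep_zero A (mem_triangle.mpr ⟨hj.1, by omega, hi⟩)]
  rfl

theorem rowSum_unitArray (m : Fin n) (i : ℕ) :
    rowSum (unitArray n m) i = if i = m + 1 then 1 else 0 := by
  rw [rowSum]
  simp only [entry_unitArray]
  by_cases hi : i = m + 1
  · subst hi
    simp
  · simp [hi]

/-- A shift moves whole rows and adds only a zero at the end of each, so row sums shift as well; a
unit at the `i`-th diagonal position raises only the `i`-th row sum. -/
theorem rowSums_triStep (j : Fin (n + 1)) (A : TriArray n) :
    rowSums n (triStep n j A) = boardStep n j (rowSums n A) := by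
  ext i
  refine Fin.cases ?_ (fun m => ?_) j
  · simp only [rowSums, boardStep, Fin.cases_zero, rowSum_triStep_zero A i.2]
    rcases i with ⟨_ | i, hi⟩ <;> simp [rowSum]
  · simp only [rowSums, boardStep, Fin.cases_succ, triStep_succ]
    have h : rowSum (A + unitArray n m) (i + 1) =
        rowSum A (i + 1) + rowSum (unitArray n m) (i + 1) := by
      simp only [rowSum, entry_add, Finset.sum_add_distrib]
    rw [h, rowSum_unitArray]
    by_cases him : i = m
    · simp [him]
    · have : ¬ (i : ℕ) = m := fun h => him (Fin.ext h)
      simp [him, this]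

/-- Each shift moves every diagonal one place away from the main one, which is refilled with zeros.
-/
theorem entry_foldl_replicate_zero (A : TriArray n) (m : ℕ) {k j : ℕ} (h : k < j + m) :
    entry ((List.replicate m (0 : Fin (n + 1))).foldl (fun s i => triStep n i s) A) k j = 0 := by
  induction m generalizing k j with
  | zero => exact entry_of_notMem _ fun h' => by have := mem_triangle.mp h'; omega
  | succ m ih =>
    rw [List.replicate_succ', List.foldl_append]
    by_cases hkj : (k, j) ∈ triangle n
    · have := mem_triangle.mp hkj
      exact (entry_triStep_zero _ hkj).trans (ih (by omega))
    · exact entry_of_notMem _ hkj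

/-- The array from which a transition of kind `0` leads to `B`, if the diagonal of `B` vanishes,
and which has the last row `r`. -/
def liftRows (B : TriArray n) (r : Fin n → ℕ) : TriArray n :=
  fun p => if p.1.1 = n then
    r ⟨p.1.2 - 1, by
      obtain ⟨⟨k, j⟩, hp⟩ := p
      have := mem_triangle.mp hp
      simp only
      omega⟩ else entry B (p.1.1 + 1) p.1.2

theorem entry_liftRows_last (B : TriArray n) (r : Fin n → ℕ) (i : Fin n) :
    entry (liftRows B r) n (i + 1) = r i := by
  rw [entry_of_mem _ (mem_triangle.mpr ⟨by omega, i.2, le_rfl⟩)]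
  simp [liftRows]

theorem entry_liftRows_of_lt (B : TriArray n) (r : Fin n → ℕ) {k j : ℕ} (h1 : 1 ≤ j) (h2 : j ≤ k)
    (h3 : k < n) : entry (liftRows B r) k j = entry B (k + 1) j := by
  rw [entry_of_mem _ (mem_triangle.mpr ⟨h1, h2, h3.le⟩)]
  simp [liftRows, h3.ne]

theorem triStep_zero_liftRows {B : TriArray n} (hB : ∀ i, entry B i i = 0) (r : Fin n → ℕ) :
    triStep n 0 (liftRows B r) = B := by
  refine triArray_ext fun k j h1 h2 h3 => ?_
  rw [entry_triStep_zero _ (mem_triangle.mpr ⟨h1, h2, h3⟩)]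
  rcases h2.eq_or_lt with rfl | hlt
  · rw [hB, entry_of_notMem _ fun h => by have := mem_triangle.mp h; omega]
  · rw [entry_liftRows_of_lt B r h1 (by omega) (by omega), Nat.sub_add_cancel (by omega)]

/-- A shift forgets only the last row. Together with `triStep_zero_liftRows`, this parametrises the
preimages of an array with zero main diagonal by their last rows. -/
theorem eq_liftRows (A : TriArray n) :
    A = liftRows (triStep n 0 A) fun i => entry A n (i + 1) := by
  refine triArray_ext fun k j h1 h2 h3 => ?_
  rcases h3.eq_or_lt with rfl | hlt
  · have := entry_liftRows_last (triStep k 0 A) (fun i => entry A k (i + 1)) ⟨j - 1, by omega⟩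
    simp only [Nat.sub_add_cancel h1] at this
    exact this.symm
  · rw [entry_liftRows_of_lt _ _ h1 h2 hlt,
      entry_triStep_zero _ (mem_triangle.mpr ⟨h1, by omega, hlt⟩)]
    rfl

theorem liftRows_injective (B : TriArray n) : Function.Injective (liftRows B) := by
  intro r r' h
  ext i
  rw [← entry_liftRows_last B r i, h, entry_liftRows_last]

theorem entry_diag_triStep_zero (A : TriArray n) (i : ℕ) : entry (triStep n 0 A) i i = 0 := by
  by_cases h : (i, i) ∈ triangle n
  · rw [entry_triStep_zero _ h]
    refine entry_of_notMem _ fun h' => ?_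
    have := mem_triangle.mp h
    have := mem_triangle.mp h'
    omega
  · exact entry_of_notMem _ h

/-- Every array is the end of a sequence of transitions that starts at the zero array. -/
theorem exists_foldl_triStep_zero (b : TriArray n) :
    ∃ w : List (Fin (n + 1)), w.foldl (fun s j => triStep n j s) 0 = b := by
  have hadd : ∀ (b : TriArray n) (i : Fin n) (m : ℕ),
      (∃ w : List (Fin (n + 1)), w.foldl (fun s j => triStep n j s) 0 = b) →
      ∃ w : List (Fin (n + 1)), w.foldl (fun s j => triStep n j s) 0 = b + m • unitArray n i := by
    intro b i m h
    induction m with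
    | zero => simpa using h
    | succ m ih =>
      obtain ⟨w, hw⟩ := ih
      refine ⟨w ++ [i.succ], ?_⟩
      rw [List.foldl_append, hw, List.foldl_cons, List.foldl_nil, triStep_succ, add_assoc,
        succ_nsmul]
  -- Induction on the number `m` of diagonals, counted from the main one, that may be nonzero.
  -- Lifting the rows of `b` removes one of them; a shift restores the rest, and unit increments
  -- refill the main diagonal.
  have hdepth : ∀ (m : ℕ) (b : TriArray n), (∀ k j, j + m ≤ k → entry b k j = 0) →
      ∃ w : List (Fin (n + 1)), w.foldl (fun s j => triStep n j s) 0 = b := by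
    intro m
    induction m with
    | zero =>
      intro b hb
      exact ⟨[], triArray_ext fun k j _ h2 _ => by rw [hb k j h2, List.foldl_nil, entry_zero]⟩
    | succ m ih =>
      intro b hb
      obtain ⟨w, hw⟩ := ih (liftRows b 0) fun k j hkj => by
        by_cases h : (k, j) ∈ triangle n
        · obtain ⟨h1, h2, h3⟩ := mem_triangle.mp h
          rcases h3.eq_or_lt with rfl | hlt
          · have := entry_liftRows_last b 0 ⟨j - 1, by omega⟩
            simp only [Nat.sub_add_cancel h1] at this
            exact this
          · rw [entry_liftRows_of_lt _ _ h1 h2 hlt, hb _ _ (by omega)]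
        · exact entry_of_notMem _ h
      have hsum : ∀ s : Finset (Fin n), ∃ w : List (Fin (n + 1)),
          w.foldl (fun s j => triStep n j s) 0 = triStep n 0 (liftRows b 0) +
            ∑ i ∈ s, entry b (i + 1) (i + 1) • unitArray n i := by
        classical
        intro s
        induction s using Finset.induction_on with
        | empty => exact ⟨w ++ [0], by rw [List.foldl_append, hw]; simp⟩
        | insert i s hi ih' =>
          obtain ⟨w', hw'⟩ := hadd _ i (entry b (i + 1) (i + 1)) ih'
          exact ⟨w', by rw [hw', Finset.sum_insert hi, add_assoc, add_comm (∑ i ∈ s, _)]⟩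
      obtain ⟨w', hw'⟩ := hsum Finset.univ
      refine ⟨w', hw'.trans (triArray_ext fun k j h1 h2 h3 => ?_)⟩
      have hes : entry (∑ i : Fin n, entry b (i + 1) (i + 1) • unitArray n i) k j =
          if k = j then entry b k j else 0 := by
        have hes' : ∀ s : Finset (Fin n),
            entry (∑ i ∈ s, entry b (i + 1) (i + 1) • unitArray n i) k j =
              ∑ i ∈ s, if k = i + 1 ∧ j = i + 1 then entry b (i + 1) (i + 1) else 0 := by
          classical
          intro s
          induction s using Finset.induction_on with
          | empty => simp [entry_zero]
          | insert i s hi ih' =>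
            rw [Finset.sum_insert hi, Finset.sum_insert hi, entry_add, ih', entry_nsmul,
              entry_unitArray]
            simp
        rw [hes']
        split_ifs with hkj
        · subst hkj
          rw [Finset.sum_eq_single ⟨k - 1, by omega⟩]
          · simp [Nat.sub_add_cancel h1]
          · intro i _ hi
            refine if_neg fun h => hi (Fin.ext ?_)
            simp only
            omega
          · simp
        · exact Finset.sum_eq_zero fun i _ => if_neg fun h => hkj (h.1.trans h.2.symm)
      rw [entry_add, hes]
      rcases h2.eq_or_lt with rfl | hlt
      · rw [entry_diag_triStep_zero, if_pos rfl, zero_add]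
      · rw [if_neg hlt.ne', entry_triStep_zero _ (mem_triangle.mpr ⟨h1, h2, h3⟩),
          entry_liftRows_of_lt _ _ h1 (by omega) (by omega),
          Nat.sub_add_cancel (by omega), add_zero]
  refine hdepth (n + 1) b fun k j hkj => entry_of_notMem _ fun h => ?_
  have := mem_triangle.mp h
  omega

theorem exists_reset_triStep (b : TriArray n) :
    ∃ w : List (Fin (n + 1)), ∀ c, w.foldl (fun s j => triStep n j s) c = b := by
  obtain ⟨w, hw⟩ := exists_foldl_triStep_zero b
  refine ⟨List.replicate n 0 ++ w, fun c => ?_⟩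
  have h0 : (List.replicate n (0 : Fin (n + 1))).foldl (fun s j => triStep n j s) c = 0 := by
    refine triArray_ext fun k j h1 h2 h3 => ?_
    rw [entry_foldl_replicate_zero c n (by omega), entry_zero]
  rw [List.foldl_append, h0, hw]

theorem nontrivial_triArray (hn : 1 ≤ n) : Nontrivial (TriArray n) := by
  refine ⟨⟨0, unitArray n ⟨0, hn⟩, fun h => ?_⟩⟩
  have := congrArg (fun A => entry A 1 1) h
  simp [entry_zero, entry_unitArray] at this

end Board

/-! ### The negative multinomial law of a single diagonal. -/

section DiagFactor

/-- The stationary probability of the content `c 1, …, c k` of the `k`-th diagonal. -/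
def diagFactor (X : ℕ → ℝ) (k : ℕ) (c : ℕ → ℕ) : ℝ :=
  X 0 * Nat.multinomial (Finset.Icc 1 k) c * (∏ j ∈ Finset.Icc 1 k, X j ^ c j) /
    (∑ j ∈ Finset.range (k + 1), X j) ^ (∑ j ∈ Finset.Icc 1 k, c j + 1)

variable {X : ℕ → ℝ}

theorem diagFactor_congr {k : ℕ} {c c' : ℕ → ℕ} (h : ∀ j ∈ Finset.Icc 1 k, c j = c' j) :
    diagFactor X k c = diagFactor X k c' := by
  rw [diagFactor, diagFactor, Nat.multinomial_congr h, Finset.sum_congr rfl h,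
    Finset.prod_congr rfl fun j hj => by rw [h j hj]]

theorem diagFactor_nonneg (hX : ∀ j, 0 < X j) (k : ℕ) (c : ℕ → ℕ) : 0 ≤ diagFactor X k c := by
  have h1 : 0 < ∑ j ∈ Finset.range (k + 1), X j := Finset.sum_pos (fun j _ => hX j) (by simp)
  have h2 : 0 ≤ ∏ j ∈ Finset.Icc 1 k, X j ^ c j :=
    Finset.prod_nonneg fun j _ => (pow_pos (hX j) _).le
  have := hX 0
  unfold diagFactor
  positivity

theorem diagFactor_zero (hX : ∀ j, 0 < X j) (c : ℕ → ℕ) : diagFactor X 0 c = 1 := by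
  simp [diagFactor, (hX 0).ne']

/-- Marginals of a negative multinomial law are of the same kind: this is the series `∑ m, (m +
D).choose D * q ^ m = 1 / (1 - q) ^ (D + 1)` with `q = z / (Y + z)`. -/
theorem hasSum_diagFactor_succ (hX : ∀ j, 0 < X j) (k : ℕ) (c : ℕ → ℕ) :
    HasSum (fun m => diagFactor X (k + 1) (Function.update c (k + 1) m)) (diagFactor X k c) := by
  set Y := ∑ j ∈ Finset.range (k + 1), X j with hY
  have hY0 : 0 < Y := Finset.sum_pos (fun j _ => hX j) (by simp)
  set z := X (k + 1) with hz
  have hz0 : 0 < z := hX (k + 1)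
  set D := ∑ j ∈ Finset.Icc 1 k, c j with hD
  set M := (Nat.multinomial (Finset.Icc 1 k) c : ℝ) with hM
  set P := ∏ j ∈ Finset.Icc 1 k, X j ^ c j with hP
  have hins : Finset.Icc 1 (k + 1) = insert (k + 1) (Finset.Icc 1 k) := by
    ext j
    simp only [Finset.mem_insert, Finset.mem_Icc]
    omega
  have hnot : k + 1 ∉ Finset.Icc 1 k := by simp
  have hupd : ∀ m, ∀ j ∈ Finset.Icc 1 k, Function.update c (k + 1) m j = c j := by
    intro m j hj
    exact Function.update_of_ne (ne_of_mem_of_not_mem hj hnot) _ _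
  have hterm : ∀ m, diagFactor X (k + 1) (Function.update c (k + 1) m) =
      X 0 * M * P / (Y + z) ^ (D + 1) * (((m + D).choose D : ℝ) * (z / (Y + z)) ^ m) := by
    intro m
    rw [diagFactor, hins, Nat.multinomial_insert hnot, Finset.prod_insert hnot,
      Finset.sum_insert hnot, Finset.sum_congr rfl (hupd m), Nat.multinomial_congr (hupd m),
      Finset.prod_congr rfl fun j hj => by rw [hupd m j hj], Function.update_self,
      Finset.sum_range_succ, ← hY, ← hz, ← hD, ← hP, Nat.choose_symm_add, Nat.cast_mul, ← hM,
      show m + D + 1 = (D + 1) + m by ring, pow_add, div_pow]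
    field_simp
  simp only [hterm]
  have hq : ‖z / (Y + z)‖ < 1 := by
    rw [Real.norm_of_nonneg (by positivity), div_lt_one (by positivity)]
    linarith
  have h := (hasSum_choose_mul_geometric_of_norm_lt_one D hq).mul_left
    (X 0 * M * P / (Y + z) ^ (D + 1))
  have h1 : 1 - z / (Y + z) = Y / (Y + z) := by
    field_simp
    ring
  have h2 : diagFactor X k c = X 0 * M * P / (Y + z) ^ (D + 1) *
      (1 / (1 - z / (Y + z)) ^ (D + 1)) := by
    have h3 : diagFactor X k c = X 0 * M * P / Y ^ (D + 1) := rfl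
    rw [h3, h1, div_pow]
    field_simp
  rw [h2]
  exact h

theorem multinomial_update_sub_one {s : Finset ℕ} {c : ℕ → ℕ} {i : ℕ} (hi : i ∈ s) (hc : 0 < c i) :
    (∑ j ∈ s, c j) * Nat.multinomial s (Function.update c i (c i - 1)) =
      c i * Nat.multinomial s c := by
  set c' := Function.update c i (c i - 1) with hc'
  have hc'i : c' i + 1 = c i := by
    rw [hc', Function.update_self]
    omega
  have hoff : ∀ j ∈ s.erase i, c' j = c j := fun j hj =>
    Function.update_of_ne (Finset.ne_of_mem_erase hj) _ _
  have hsum : ∑ j ∈ s, c j = ∑ j ∈ s, c' j + 1 := by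
    rw [← Finset.add_sum_erase s c hi, ← Finset.add_sum_erase s c' hi, Finset.sum_congr rfl hoff,
      ← hc'i]
    ring
  have hfac : ∏ j ∈ s, (c j)! = c i * ∏ j ∈ s, (c' j)! := by
    rw [← Finset.mul_prod_erase s (fun j => (c j)!) hi,
      ← Finset.mul_prod_erase s (fun j => (c' j)!) hi,
      ← hc'i, Nat.factorial_succ, mul_assoc,
      Finset.prod_congr rfl fun j hj => congrArg Nat.factorial (hoff j hj)]
  have h1 := Nat.multinomial_spec s c
  have h2 := Nat.multinomial_spec s c'
  rw [hsum, Nat.factorial_succ, ← h2, hfac] at h1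
  have hpos : 0 < ∏ j ∈ s, (c' j)! := Finset.prod_pos fun j _ => Nat.factorial_pos _
  rw [hsum]
  refine Nat.eq_of_mul_eq_mul_left hpos ?_
  linarith

open scoped Classical in
/-- The balance equation of a single diagonal. -/
theorem diagFactor_balance (hX : ∀ j, 0 < X j) (k : ℕ) (c : ℕ → ℕ) :
    X 0 * (if ∀ j ∈ Finset.Icc 1 k, c j = 0 then 1 else 0) +
      ∑ i ∈ Finset.Icc 1 k, X i *
        (if 0 < c i then diagFactor X k (Function.update c i (c i - 1)) else 0) =
      (∑ j ∈ Finset.range (k + 1), X j) * diagFactor X k c := by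
  set Y := ∑ j ∈ Finset.range (k + 1), X j with hY
  have hY0 : 0 < Y := Finset.sum_pos (fun j _ => hX j) (by simp)
  by_cases h0 : ∀ j ∈ Finset.Icc 1 k, c j = 0
  · rw [if_pos h0, Finset.sum_eq_zero fun i hi => by rw [if_neg (by simp [h0 i hi]), mul_zero],
      diagFactor_congr (c' := fun _ => 0) h0, diagFactor, ← hY]
    have : Nat.multinomial (Finset.Icc 1 k) (fun _ => 0) = 1 := by simp [Nat.multinomial]
    simp only [this, pow_zero, Finset.prod_const_one, Finset.sum_const_zero]
    field_simp
    simp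
  · rw [if_neg h0, mul_zero, zero_add]
    set D := ∑ j ∈ Finset.Icc 1 k, c j with hD
    have hD0 : 0 < D := by
      refine Nat.pos_of_ne_zero fun h => h0 ?_
      simpa using Finset.sum_eq_zero_iff.mp h
    have hDR : (0 : ℝ) < D := by exact_mod_cast hD0
    -- Lowering `c i` by one multiplies the multinomial coefficient by `c i / D`. The inflow through
    -- `i` is therefore the share `c i / D` of the outflow, and the shares sum to one.
    have hterm : ∀ i ∈ Finset.Icc 1 k, X i *
        (if 0 < c i then diagFactor X k (Function.update c i (c i - 1)) else 0) =
        c i * (Y * diagFactor X k c / D) := by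
      intro i hi
      by_cases hci : 0 < c i
      · rw [if_pos hci]
        set c' := Function.update c i (c i - 1) with hc'
        have hmul : (D : ℝ) * Nat.multinomial (Finset.Icc 1 k) c' =
            c i * Nat.multinomial (Finset.Icc 1 k) c := by
          exact_mod_cast multinomial_update_sub_one hi hci
        have hc'i : c' i + 1 = c i := by
          rw [hc', Function.update_self]
          omega
        have hoff : ∀ j ∈ (Finset.Icc 1 k).erase i, c' j = c j := fun j hj =>
          Function.update_of_ne (Finset.ne_of_mem_erase hj) _ _
        have hsum : ∑ j ∈ Finset.Icc 1 k, c' j + 1 = D := by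
          rw [hD, ← Finset.add_sum_erase _ c hi, ← Finset.add_sum_erase _ c' hi,
            Finset.sum_congr rfl hoff, ← hc'i]
          ring
        have hprod : ∏ j ∈ Finset.Icc 1 k, X j ^ c j =
            X i * ∏ j ∈ Finset.Icc 1 k, X j ^ c' j := by
          rw [← Finset.mul_prod_erase _ (fun j => X j ^ c j) hi,
            ← Finset.mul_prod_erase _ (fun j => X j ^ c' j) hi,
            Finset.prod_congr rfl fun j hj => congrArg (X j ^ ·) (hoff j hj), ← hc'i, pow_succ']
          ring
        rw [diagFactor, diagFactor, ← hY, ← hD, hsum, hprod, pow_succ]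
        field_simp
        linear_combination (X 0 * X i * ∏ j ∈ Finset.Icc 1 k, X j ^ c' j) * hmul
      · have : c i = 0 := by omega
        simp [this]
    rw [Finset.sum_congr rfl hterm, ← Finset.sum_mul]
    have : ∑ i ∈ Finset.Icc 1 k, (c i : ℝ) = D := by exact_mod_cast rfl
    rw [this]
    field_simp

end DiagFactor

/-! ### The weight as a product over diagonals, and its images under shifts. -/

section Weight

variable {n : ℕ}

/-- The `k`-th diagonal of an array. -/
def diagonal (A : TriArray n) (k : ℕ) : ℕ → ℕ := fun j => entry A (n - k + j) j

/-- The rates as a function on the natural numbers. -/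
def natRate (x : Fin (n + 1) → ℝ) (j : ℕ) : ℝ := if h : j < n + 1 then x ⟨j, h⟩ else 1

/-- The default value 1 beyond `n` makes positivity hold for every index. -/
theorem natRate_pos {x : Fin (n + 1) → ℝ} (hx : ∀ i, 0 < x i) (j : ℕ) : 0 < natRate x j := by
  unfold natRate
  split_ifs
  exacts [hx _, one_pos]

theorem natRate_val (x : Fin (n + 1) → ℝ) (i : Fin (n + 1)) : natRate x i = x i := by
  simp [natRate, i.2]

theorem partialRate_eq (x : Fin (n + 1) → ℝ) (k : Fin (n + 1)) :
    partialRate x k = ∑ j ∈ Finset.range (k + 1), natRate x j := by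
  rw [partialRate]
  refine Finset.sum_bij (fun j _ => (j : ℕ)) ?_ ?_ ?_ ?_
  · intro j hj
    rw [Finset.mem_Iic] at hj
    exact Finset.mem_range_succ_iff.mpr hj
  · exact fun _ _ _ _ h => Fin.ext h
  · intro j hj
    rw [Finset.mem_range_succ_iff] at hj
    exact ⟨⟨j, by omega⟩, Finset.mem_Iic.mpr hj, rfl⟩
  · exact fun j _ => (natRate_val x j).symm

theorem totalRate_eq (x : Fin (n + 1) → ℝ) :
    totalRate x = ∑ j ∈ Finset.range (n + 1), natRate x j := by
  rw [totalRate, ← Fin.sum_univ_eq_sum_range]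
  exact Finset.sum_congr rfl fun j _ => (natRate_val x j).symm

/-- The powers of the rates are grouped by columns in the weight and by diagonals in the factors;
the two double products run over the same positions. -/
theorem weight_eq_prod (x : Fin (n + 1) → ℝ) (A : TriArray n) :
    weight x A = ∏ k ∈ Finset.range n, diagFactor (natRate x) (k + 1) (diagonal A (k + 1)) := by
  have hpow : ∏ i : Fin n, x i.succ ^ colSum A ((i : ℕ) + 1) =
      ∏ k ∈ Finset.range n, ∏ j ∈ Finset.Icc 1 (k + 1), natRate x j ^ diagonal A (k + 1) j := by
    have h1 : ∏ i : Fin n, x i.succ ^ colSum A ((i : ℕ) + 1) =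
        ∏ i ∈ Finset.range n, ∏ k ∈ Finset.Ico i n,
          natRate x (i + 1) ^ diagonal A (k + 1) (i + 1) := by
      rw [← Fin.prod_univ_eq_prod_range]
      refine Finset.prod_congr rfl fun i _ => ?_
      rw [Finset.prod_pow_eq_pow_sum]
      have hxi : natRate x (i + 1) = x i.succ := natRate_val x i.succ
      rw [hxi, colSum]
      congr 1
      -- The entry in row `k` and column `i + 1` lies on the diagonal with index `(n + i - k) + 1`.
      refine Finset.sum_bij' (fun k _ => n + i - k) (fun k _ => n + i - k) ?_ ?_ ?_ ?_ ?_
      · intro k hk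
        simp only [Finset.mem_Icc, Finset.mem_Ico] at hk ⊢
        omega
      · intro k hk
        simp only [Finset.mem_Icc, Finset.mem_Ico] at hk ⊢
        omega
      · intro k hk
        simp only [Finset.mem_Icc] at hk
        omega
      · intro k hk
        simp only [Finset.mem_Ico] at hk
        omega
      · intro k hk
        simp only [Finset.mem_Icc] at hk
        rw [diagonal]
        congr 1
        omega
    rw [h1]
    have h2 : ∀ k, ∏ j ∈ Finset.Icc 1 (k + 1), natRate x j ^ diagonal A (k + 1) j =
        ∏ i ∈ Finset.range (k + 1), natRate x (i + 1) ^ diagonal A (k + 1) (i + 1) := by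
      intro k
      rw [Finset.range_eq_Ico, Finset.prod_Ico_add' (fun j => natRate x j ^ diagonal A (k + 1) j)]
      rfl
    simp only [h2]
    refine Finset.prod_comm' fun i k => ?_
    simp only [Finset.mem_range, Finset.mem_Ico]
    omega
  have hx0 : x 0 ^ n = ∏ _k ∈ Finset.range n, natRate x 0 := by
    rw [Finset.prod_const, Finset.card_range]
    congr 1
  rw [weight, Finset.prod_mul_distrib, Finset.prod_div_distrib, hpow, hx0]
  simp only [diagFactor]
  rw [Finset.prod_div_distrib, Finset.prod_mul_distrib, Finset.prod_mul_distrib]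
  have h3 : ∏ i : Fin n, partialRate x i.succ ^ (diagSum A ((i : ℕ) + 1) + 1) =
      ∏ k ∈ Finset.range n, (∑ j ∈ Finset.range (k + 1 + 1), natRate x j) ^
        (∑ j ∈ Finset.Icc 1 (k + 1), diagonal A (k + 1) j + 1) := by
    rw [← Fin.prod_univ_eq_prod_range]
    refine Finset.prod_congr rfl fun i _ => ?_
    rw [partialRate_eq]
    rfl
  have h4 : ∏ i : Fin n, (Nat.multinomial (Finset.Icc 1 ((i : ℕ) + 1))
      (fun j => entry A (n - ((i : ℕ) + 1) + j) j) : ℝ) =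
      ∏ k ∈ Finset.range n,
        (Nat.multinomial (Finset.Icc 1 (k + 1)) (diagonal A (k + 1)) : ℝ) := by
    rw [← Fin.prod_univ_eq_prod_range]
    rfl
  rw [h3, h4]
  ring

theorem tsum_pi_prod {n : ℕ} (F : Fin n → ℕ → ℝ≥0∞) :
    ∑' r : Fin n → ℕ, ∏ k, F k (r k) = ∏ k, ∑' m, F k m := by
  induction n with
  | zero => simp
  | succ n ih =>
    rw [← (Fin.consEquiv fun _ => ℕ).tsum_eq, ENNReal.tsum_prod', Fin.prod_univ_succ, ← ih,
      ← ENNReal.tsum_mul_right]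
    refine tsum_congr fun m => ?_
    rw [← ENNReal.tsum_mul_left]
    refine tsum_congr fun r => ?_
    simp [Fin.consEquiv, Fin.prod_univ_succ]

/-- The image under the transition of kind `0` of a measure that is a product over the
diagonals. -/
theorem tsum_prod_diagonal_triStep_zero {Φ : ℕ → (ℕ → ℕ) → ℝ≥0∞}
    (hΦ : ∀ k c c', (∀ j ∈ Finset.Icc 1 k, c j = c' j) → Φ k c = Φ k c') (B : TriArray n)
    (hB : ∀ i, entry B i i = 0) :
    ∑' A, (if triStep n 0 A = B then
        ∏ k ∈ Finset.range n, Φ (k + 1) (diagonal A (k + 1)) else 0) =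
      ∏ k ∈ Finset.range n, ∑' m, Φ (k + 1) (Function.update (diagonal B k) (k + 1) m) := by
  classical
  have hsupp : Function.support (fun A => if triStep n 0 A = B then
      ∏ k ∈ Finset.range n, Φ (k + 1) (diagonal A (k + 1)) else 0) ⊆ Set.range (liftRows B) := by
    intro A hA
    have : triStep n 0 A = B := by
      by_contra h
      simp [h] at hA
    rw [eq_liftRows A, this]
    exact Set.mem_range_self _
  -- Sum over the last row `r` of the preimage. Each coordinate of `r` lies on exactly one diagonal,
  -- so the sum factorises.
  rw [← (liftRows_injective B).tsum_eq hsupp, ← Fin.prod_univ_eq_prod_range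
    (fun k => ∑' m, Φ (k + 1) (Function.update (diagonal B k) (k + 1) m)), ← tsum_pi_prod]
  refine tsum_congr fun r => ?_
  rw [if_pos (triStep_zero_liftRows hB r), ← Fin.prod_univ_eq_prod_range
    (fun k => Φ (k + 1) (diagonal (liftRows B r) (k + 1)))]
  refine Finset.prod_congr rfl fun k _ => hΦ _ _ _ fun j hj => ?_
  rw [Finset.mem_Icc] at hj
  have hk := k.2
  by_cases hjk : j = k + 1
  · subst hjk
    rw [Function.update_self, diagonal, Nat.sub_add_cancel (by omega), entry_liftRows_last]
  · rw [Function.update_of_ne hjk, diagonal, diagonal,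
      entry_liftRows_of_lt B r hj.1 (by omega) (by omega)]
    congr 1
    omega

open scoped Classical in
/-- The factors of the image of the stationary measure under `m` transitions of kind `0`. -/
def shiftedFactor (X : ℕ → ℝ) (n m k : ℕ) (c : ℕ → ℕ) : ℝ≥0∞ :=
  if k + m ≤ n then ENNReal.ofReal (diagFactor X k c)
  else if ∀ j ∈ Finset.Icc 1 k, c j = 0 then 1 else 0

/-- The image of the stationary measure under `m` transitions of kind `0`. -/
def shiftedWeight (X : ℕ → ℝ) (m : ℕ) (A : TriArray n) : ℝ≥0∞ :=
  ∏ k ∈ Finset.range n, shiftedFactor X n m (k + 1) (diagonal A (k + 1))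

theorem shiftedFactor_congr (X : ℕ → ℝ) (m k : ℕ) (c c' : ℕ → ℕ)
    (h : ∀ j ∈ Finset.Icc 1 k, c j = c' j) :
    shiftedFactor X n m k c = shiftedFactor X n m k c' := by
  have h' : (∀ j ∈ Finset.Icc 1 k, c j = 0) ↔ ∀ j ∈ Finset.Icc 1 k, c' j = 0 :=
    forall₂_congr fun j hj => by rw [h j hj]
  rw [shiftedFactor, shiftedFactor, diagFactor_congr h]
  by_cases hc : ∀ j ∈ Finset.Icc 1 k, c j = 0
  · rw [if_pos hc, if_pos (h'.mp hc)]
  · rw [if_neg hc, if_neg fun h'' => hc (h'.mpr h'')]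

/-- Either the negative binomial summation or the summation of a point mass at zero. -/
theorem tsum_shiftedFactor {X : ℕ → ℝ} (hX : ∀ j, 0 < X j) (m k : ℕ) (c : ℕ → ℕ) :
    ∑' i, shiftedFactor X n m (k + 1) (Function.update c (k + 1) i) =
      shiftedFactor X n (m + 1) k c := by
  by_cases h : k + 1 + m ≤ n
  · have h' : k + (m + 1) ≤ n := by omega
    simp only [shiftedFactor, h, h', if_true]
    rw [← ENNReal.ofReal_tsum_of_nonneg (fun i => diagFactor_nonneg hX _ _)
      (hasSum_diagFactor_succ hX k c).summable, (hasSum_diagFactor_succ hX k c).tsum_eq]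
  · have h' : ¬ k + (m + 1) ≤ n := by omega
    have hiff : ∀ i, (∀ j ∈ Finset.Icc 1 (k + 1), Function.update c (k + 1) i j = 0) ↔
        i = 0 ∧ ∀ j ∈ Finset.Icc 1 k, c j = 0 := by
      intro i
      constructor
      · intro hi
        refine ⟨by simpa using hi (k + 1) (by simp), fun j hj => ?_⟩
        rw [Finset.mem_Icc] at hj
        have := hi j (Finset.mem_Icc.mpr ⟨hj.1, by omega⟩)
        rwa [Function.update_of_ne (by omega)] at this
      · rintro ⟨rfl, hc⟩ j hj
        rw [Finset.mem_Icc] at hj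
        by_cases hjk : j = k + 1
        · rw [hjk, Function.update_self]
        · rw [Function.update_of_ne hjk]
          exact hc j (Finset.mem_Icc.mpr ⟨hj.1, by omega⟩)
    simp only [shiftedFactor, h, h', if_false, hiff]
    rw [tsum_eq_single 0 fun i hi => by simp [hi]]
    simp

theorem diagonal_self_eq (A : TriArray n) (j : ℕ) : diagonal A n j = entry A j j := by
  simp [diagonal]

open scoped Classical in
-- Summing out the last row turns the factor of diagonal `k + 1` into that of diagonal `k`. The
-- factor with index 0 is 1, and the emptied main diagonal supplies a new point mass.
theorem tsum_shiftedWeight_triStep_zero {X : ℕ → ℝ} (hX : ∀ j, 0 < X j) (m : ℕ)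
    (B : TriArray n) :
    ∑' A, (if triStep n 0 A = B then shiftedWeight X m A else 0) = shiftedWeight X (m + 1) B := by
  have hdiag : (∀ j ∈ Finset.Icc 1 n, diagonal B n j = 0) ↔ ∀ i, entry B i i = 0 := by
    constructor
    · intro h i
      by_cases hi : (i, i) ∈ triangle n
      · rw [← diagonal_self_eq]
        have := mem_triangle.mp hi
        exact h i (Finset.mem_Icc.mpr ⟨this.1, this.2.2⟩)
      · exact entry_of_notMem _ hi
    · intro h j _
      rw [diagonal_self_eq, h]
  have h0 : shiftedFactor X n (m + 1) 0 (diagonal B 0) = 1 := by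
    simp [shiftedFactor, diagFactor_zero hX]
  have hn : shiftedFactor X n (m + 1) n (diagonal B n) =
      if ∀ i, entry B i i = 0 then 1 else 0 := by
    have : ¬ n + (m + 1) ≤ n := by omega
    simp only [shiftedFactor, this, if_false, hdiag]
  have hprod : shiftedWeight X (m + 1) B =
      (∏ k ∈ Finset.range n, shiftedFactor X n (m + 1) k (diagonal B k)) *
        if ∀ i, entry B i i = 0 then 1 else 0 := by
    rw [← hn, ← Finset.prod_range_succ (fun k => shiftedFactor X n (m + 1) k (diagonal B k)),
      Finset.prod_range_succ', h0, mul_one, shiftedWeight]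
  rw [hprod]
  by_cases hB : ∀ i, entry B i i = 0
  · rw [if_pos hB, mul_one]
    simp only [shiftedWeight]
    rw [tsum_prod_diagonal_triStep_zero (shiftedFactor_congr X m) B hB]
    exact Finset.prod_congr rfl fun k _ => tsum_shiftedFactor hX m k _
  · rw [if_neg hB, mul_zero]
    refine ENNReal.tsum_eq_zero.mpr fun A => if_neg fun h => hB fun i => ?_
    rw [← h, entry_diag_triStep_zero]

/-- Pushing forward preserves mass, and after `n` shifts every factor is a point mass at zero. -/
theorem tsum_shiftedWeight_eq_one {X : ℕ → ℝ} (hX : ∀ j, 0 < X j) :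
    ∑' A : TriArray n, shiftedWeight X 0 A = 1 := by
  have hstep : ∀ m, ∑' A : TriArray n, shiftedWeight X 0 A = ∑' A : TriArray n,
      shiftedWeight X m A := by
    intro m
    induction m with
    | zero => rfl
    | succ m ih =>
      simp only [ih, ← tsum_shiftedWeight_triStep_zero hX m]
      rw [ENNReal.tsum_comm]
      refine tsum_congr fun A => ?_
      rw [tsum_eq_single (triStep n 0 A) fun B hB => if_neg hB.symm, if_pos rfl]
  rw [hstep n, tsum_eq_single 0]
  · refine Finset.prod_eq_one fun k _ => ?_
    have : ¬ k + 1 + n ≤ n := by omega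
    simp [shiftedFactor, this, diagonal, entry_zero]
  · intro A hA
    obtain ⟨k, j, h1, h2, h3, hne⟩ : ∃ k j, 1 ≤ j ∧ j ≤ k ∧ k ≤ n ∧ entry A k j ≠ 0 := by
      by_contra! h
      exact hA (triArray_ext fun k j h1 h2 h3 => by rw [h k j h1 h2 h3, entry_zero])
    -- The position `(k, j)` lies on diagonal `n - k + j`; the factors are indexed from zero.
    refine Finset.prod_eq_zero (i := n - k + j - 1) (Finset.mem_range.mpr (by omega)) ?_
    have h4 : ¬ n - k + j - 1 + 1 + n ≤ n := by omega
    rw [shiftedFactor, if_neg h4, if_neg]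
    intro h
    have h5 := h j (Finset.mem_Icc.mpr (by omega))
    rw [diagonal, show n - (n - k + j - 1 + 1) + j = k by omega] at h5
    exact hne h5

theorem ofReal_weight {x : Fin (n + 1) → ℝ} (hx : ∀ i, 0 < x i) (A : TriArray n) :
    ENNReal.ofReal (weight x A) = shiftedWeight (natRate x) 0 A := by
  rw [weight_eq_prod, ENNReal.ofReal_prod_of_nonneg
    fun k _ => diagFactor_nonneg (natRate_pos hx) _ _, shiftedWeight]
  refine Finset.prod_congr rfl fun k hk => ?_
  have : k + 1 + 0 ≤ n := by have := Finset.mem_range.mp hk; omega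
  rw [shiftedFactor, if_pos this]

theorem weight_nonneg {x : Fin (n + 1) → ℝ} (hx : ∀ i, 0 < x i) (A : TriArray n) :
    0 ≤ weight x A := by
  rw [weight_eq_prod]
  exact Finset.prod_nonneg fun k _ => diagFactor_nonneg (natRate_pos hx) _ _

end Weight

/-! ### The balance equations for the weight. -/

section Balance

open scoped Classical in
-- Push `π` forward under each `T j`, multiply the pointwise balance by `f b`, and sum over `b`.
theorem balance_of_tsum_ite {S ι : Type*} [Fintype ι] {r : ι → ℝ} {T : ι → S → S}
    {π : S → ℝ≥0∞} {Λ : ℝ≥0∞}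
    (h : ∀ b, ∑ j, ENNReal.ofReal (r j) * ∑' a, (if T j a = b then π a else 0) = Λ * π b)
    (f : S → ℝ≥0∞) : ∑' a, π a * jumpOp r T f a = Λ * ∑' a, π a * f a := by
  have hpush : ∀ j, ∑' a, π a * f (T j a) = ∑' b, (∑' a, if T j a = b then π a else 0) * f b := by
    intro j
    simp only [← ENNReal.tsum_mul_right]
    rw [ENNReal.tsum_comm]
    refine tsum_congr fun a => ?_
    rw [tsum_eq_single (T j a) fun b hb => by rw [if_neg hb.symm, zero_mul], if_pos rfl]
  calc ∑' a, π a * jumpOp r T f a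
      = ∑ j, ENNReal.ofReal (r j) * ∑' a, π a * f (T j a) := by
        simp only [jumpOp, Finset.mul_sum]
        rw [Summable.tsum_finsetSum fun _ _ => ENNReal.summable]
        refine Finset.sum_congr rfl fun j _ => ?_
        rw [← ENNReal.tsum_mul_left]
        exact tsum_congr fun a => by ring
    _ = ∑' b, (∑ j, ENNReal.ofReal (r j) * ∑' a, (if T j a = b then π a else 0)) * f b := by
        simp only [hpush, Finset.sum_mul]
        rw [Summable.tsum_finsetSum fun _ _ => ENNReal.summable]
        refine Finset.sum_congr rfl fun j _ => ?_
        rw [← ENNReal.tsum_mul_left]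
        exact tsum_congr fun b => by ring
    _ = Λ * ∑' a, π a * f a := by
        simp only [h]
        rw [← ENNReal.tsum_mul_left]
        exact tsum_congr fun b => by ring

variable {n : ℕ}

theorem entry_sub (A B : TriArray n) (k j : ℕ) : entry (A - B) k j = entry A k j - entry B k j := by
  by_cases h : (k, j) ∈ triangle n
  · simp [entry_of_mem _ h]
  · simp [entry_of_notMem _ h]

open scoped Classical in
theorem tsum_ite_triStep_succ (w : TriArray n → ℝ≥0∞) (i : Fin n) (B : TriArray n) :
    ∑' A, (if triStep n i.succ A = B then w A else 0) =
      if 0 < entry B (i + 1) (i + 1) then w (B - unitArray n i) else 0 := by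
  simp only [triStep_succ]
  split_ifs with hB
  · have hle : unitArray n i ≤ B := by
      rintro ⟨⟨k, j⟩, hp⟩
      by_cases hkj : (k, j) = ((i : ℕ) + 1, (i : ℕ) + 1)
      · obtain ⟨rfl, rfl⟩ := Prod.mk.inj hkj
        rw [entry_of_mem B hp] at hB
        simpa [unitArray] using Nat.succ_le_of_lt hB
      · simp [unitArray, hkj]
    rw [tsum_eq_single (B - unitArray n i), if_pos (tsub_add_cancel_of_le hle)]
    intro A hA
    refine if_neg fun h => hA ?_
    rw [← h, add_tsub_cancel_right]
  · refine ENNReal.tsum_eq_zero.mpr fun A => if_neg fun h => hB ?_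
    rw [← h, entry_add, entry_unitArray]
    simp

open scoped Classical in
/-- The balance equations for the weight. -/
theorem weight_balance (hn : 1 ≤ n) {x : Fin (n + 1) → ℝ} (hx : ∀ i, 0 < x i) (B : TriArray n) :
    ∑ j, ENNReal.ofReal (x j) *
        ∑' A, (if triStep n j A = B then ENNReal.ofReal (weight x A) else 0) =
      ENNReal.ofReal (totalRate x) * ENNReal.ofReal (weight x B) := by
  have hX := natRate_pos hx
  set X := natRate x with hXdef
  simp only [ofReal_weight hx, ← hXdef]
  rw [Fin.sum_univ_succ, tsum_shiftedWeight_triStep_zero hX]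
  simp only [tsum_ite_triStep_succ]
  obtain ⟨N, rfl⟩ : ∃ N, n = N + 1 := ⟨n - 1, by omega⟩
  -- All terms of the balance equation share the factors of the diagonals below the main one and
  -- differ only in the main diagonal.
  set C := ∏ k ∈ Finset.range N, ENNReal.ofReal (diagFactor X (k + 1) (diagonal B (k + 1))) with hC
  set c := diagonal B (N + 1) with hc
  have hw0 : ∀ (A : TriArray (N + 1)), (∀ k < N, ∀ j, diagonal A (k + 1) j = diagonal B (k + 1) j) →
      shiftedWeight X 0 A =
        C * ENNReal.ofReal (diagFactor X (N + 1) (diagonal A (N + 1))) := by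
    intro A hA
    rw [shiftedWeight, Finset.prod_range_succ, shiftedFactor, if_pos (by omega), hC]
    congr 1
    refine Finset.prod_congr rfl fun k hk => ?_
    have hk' := Finset.mem_range.mp hk
    rw [shiftedFactor, if_pos (by omega), diagFactor_congr fun j _ => hA k hk' j]
  have hw1 : shiftedWeight X (0 + 1) B =
      C * ENNReal.ofReal (if ∀ j ∈ Finset.Icc 1 (N + 1), c j = 0 then 1 else 0) := by
    rw [shiftedWeight, Finset.prod_range_succ, shiftedFactor, if_neg (by omega), hC]
    congr 1
    · refine Finset.prod_congr rfl fun k hk => ?_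
      have hk' := Finset.mem_range.mp hk
      rw [shiftedFactor, if_pos (by omega)]
    · rw [← hc]
      split_ifs <;> simp
  have hsub : ∀ i : Fin (N + 1), shiftedWeight X 0 (B - unitArray (N + 1) i) =
      C * ENNReal.ofReal (diagFactor X (N + 1) (Function.update c (i + 1) (c (i + 1) - 1))) := by
    intro i
    rw [hw0]
    · congr 2
      refine diagFactor_congr fun j _ => ?_
      rw [diagonal_self_eq, entry_sub, entry_unitArray]
      by_cases hj : j = i + 1
      · subst hj
        simp [hc, diagonal_self_eq]
      · simp [hj, hc, diagonal_self_eq]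
    · intro k hk j
      rw [diagonal, diagonal, entry_sub, entry_unitArray, if_neg (by omega), Nat.sub_zero]
  have hdiag : ∀ i : Fin (N + 1), entry B (i + 1) (i + 1) = c (i + 1) := fun i =>
    (diagonal_self_eq B _).symm
  have hxi : ∀ i : Fin (N + 1), x i.succ = X (i + 1) := fun i => (natRate_val x i.succ).symm
  have hx0 : x 0 = X 0 := (natRate_val x 0).symm
  -- The total rate is the sum of rates in the factor of the main diagonal, so `diagFactor_balance`
  -- with `k = N + 1` applies.
  rw [hw1, hw0 B fun _ _ _ => rfl, totalRate_eq, ← hXdef, mul_left_comm,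
    mul_left_comm _ C, ← ENNReal.ofReal_mul (Finset.sum_nonneg fun j _ => (hX j).le),
    ← diagFactor_balance hX, hx0, ← ENNReal.ofReal_mul (hX 0).le]
  have hterm : ∀ i : Fin (N + 1), ENNReal.ofReal (x i.succ) *
      (if 0 < entry B (i + 1) (i + 1) then shiftedWeight X 0 (B - unitArray (N + 1) i) else 0) =
      C * ENNReal.ofReal (X (i + 1) * (if 0 < c (i + 1) then
        diagFactor X (N + 1) (Function.update c (i + 1) (c (i + 1) - 1)) else 0)) := by
    intro i
    rw [hdiag, hxi, hsub, ENNReal.ofReal_mul (hX _).le]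
    split_ifs
    · ring
    · simp
  have hnonneg : ∀ i, 0 ≤ X i * (if 0 < c i then
      diagFactor X (N + 1) (Function.update c i (c i - 1)) else 0) := fun i => by
    have h1 := (hX i).le
    have h2 := diagFactor_nonneg hX (N + 1) (Function.update c i (c i - 1))
    split_ifs <;> positivity
  have hsum : ∑ i ∈ Finset.Icc 1 (N + 1), X i * (if 0 < c i then
      diagFactor X (N + 1) (Function.update c i (c i - 1)) else 0) =
      ∑ i : Fin (N + 1), X (i + 1) * (if 0 < c (i + 1) then
        diagFactor X (N + 1) (Function.update c (i + 1) (c (i + 1) - 1)) else 0) := by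
    rw [Fin.sum_univ_eq_sum_range (fun i => X (i + 1) * (if 0 < c (i + 1) then
        diagFactor X (N + 1) (Function.update c (i + 1) (c (i + 1) - 1)) else 0)),
      Finset.range_eq_Ico, Finset.sum_Ico_add' (fun i => X i * (if 0 < c i then
        diagFactor X (N + 1) (Function.update c i (c i - 1)) else 0))]
    rfl
  simp only [hterm]
  rw [← Finset.mul_sum, ← mul_add, ← hc, hsum,
    ENNReal.ofReal_add (by have := (hX 0).le; split_ifs <;> positivity)
      (Finset.sum_nonneg fun (i : Fin (N + 1)) _ => hnonneg ((i : ℕ) + 1)),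
    ENNReal.ofReal_sum_of_nonneg fun (i : Fin (N + 1)) _ => hnonneg ((i : ℕ) + 1)]

theorem isStationary_weight (hn : 1 ≤ n) {x : Fin (n + 1) → ℝ} (hx : ∀ i, 0 < x i) :
    IsStationary x (triStep n) (weight x) := by
  refine isStationary_of_balance (fun j => (hx j).le) (weight_nonneg hx) ?_
    (balance_of_tsum_ite (T := triStep n) (π := fun A => ENNReal.ofReal (weight x A))
      fun B => ?_)
  · simp only [ofReal_weight hx]
    exact tsum_shiftedWeight_eq_one (natRate_pos hx)
  · rw [← weight_balance hn hx B]
    refine Finset.sum_congr rfl fun j _ => ?_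
    congr 1
    exact tsum_congr fun A => by congr

end Balance

end HilbertGalton

end

theorem theorem2p3 (n : ℕ) (hn : 1 ≤ n) (x : Fin (n + 1) → ℝ) (hx : ∀ i, 0 < x i) :
    -- the chain exists, for every initial law
    (∀ ν : MeasureTheory.Measure (HilbertGalton.TriArray n), MeasureTheory.IsProbabilityMeasure ν →
      ∃ (Ω : Type) (_ : MeasurableSpace Ω) (μ : MeasureTheory.Measure Ω)
        (X : ℝ≥0 → Ω → HilbertGalton.TriArray n),
        HilbertGalton.IsMarkovChain x (HilbertGalton.triStep n) μ X ∧ μ.map (X 0) = ν) ∧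
    HilbertGalton.IsIrreducibleChain x (HilbertGalton.triStep n) ∧
    HilbertGalton.IsPositiveRecurrent x (HilbertGalton.triStep n) ∧
    -- the weight is the unique stationary distribution
    HilbertGalton.IsStationary x (HilbertGalton.triStep n) (HilbertGalton.weight x) ∧
    (∀ π : HilbertGalton.TriArray n → ℝ,
      HilbertGalton.IsStationary x (HilbertGalton.triStep n) π → π = HilbertGalton.weight x) ∧
    -- the row sums of the chain form a Markov chain with the same law as the board
    (∀ (Ω : Type*) [MeasurableSpace Ω] (μ : MeasureTheory.Measure Ω)
      (X : ℝ≥0 → Ω → HilbertGalton.TriArray n),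
      HilbertGalton.IsMarkovChain x (HilbertGalton.triStep n) μ X →
      HilbertGalton.IsMarkovChain x (HilbertGalton.boardStep n) μ
        (fun t ω => HilbertGalton.rowSums n (X t ω)) ∧
      ∀ (Ω' : Type*) [MeasurableSpace Ω'] (μ' : MeasureTheory.Measure Ω')
        (Z : ℝ≥0 → Ω' → (Fin n → ℕ)),
        HilbertGalton.IsMarkovChain x (HilbertGalton.boardStep n) μ' Z →
        μ'.map (Z 0) = μ.map (fun ω => HilbertGalton.rowSums n (X 0 ω)) →
        μ.map (fun ω t => HilbertGalton.rowSums n (X t ω)) = μ'.map (fun ω t => Z t ω)) := by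
  have hx0 : ∀ j, 0 ≤ x j := fun j => (hx j).le
  have hΛ : 0 < HilbertGalton.totalRate x :=
    Finset.sum_pos (fun j _ => hx j) Finset.univ_nonempty
  have := HilbertGalton.nontrivial_triArray hn
  refine ⟨fun ν _ => HilbertGalton.exists_isMarkovChain hx0 hΛ _ ν,
    HilbertGalton.isIrreducibleChain_of_reset hx HilbertGalton.exists_reset_triStep,
    HilbertGalton.isPositiveRecurrent_of_reset hx HilbertGalton.exists_reset_triStep,
    HilbertGalton.isStationary_weight hn hx, fun π hπ => ?_, fun Ω _ μ X hX => ?_⟩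
  · obtain ⟨w, hw⟩ := HilbertGalton.exists_reset_triStep (0 : HilbertGalton.TriArray n)
    exact hπ.eq_of_reset hx hw (HilbertGalton.isStationary_weight hn hx)
  · have hY := hX.comp_of_intertwine hx0 HilbertGalton.rowSums_triStep
    exact ⟨hY, fun Ω' _ μ' Z hZ h0 => hY.map_eq hx0 hZ h0.symm⟩
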